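/- Let $m>2$ and $\tau\ge 1$ be integers, let $k=m\tau$, and put $$\Delta(\tau)=\tfrac12\,m(m+1)\bigl(1-(1-\tfrac1m)^{\tau}\bigr).$$ For $\alpha=(\alpha_1,\dots,\alpha_m)\in\mathbb R^m$ let $f(x)=\alpha_m x^m+\cdots+\alpha_1 x$. For a real random variable $S$ and a positive integer $P$ let $$I_k(P)=P^{-m(m-1)/2}\int_{-P^{m-1}}^{P^{m-1}}\int_{-P^{m-2}}^{P^{m-2}}\cdots\int_{-1}^{1}\Bigl|\mathbf E\bigl[\exp\{2\pi i f(S)\}\,\mathbf 1_{\{-P<S\le P\}}\bigr]\Bigr|^{2k}\,d\alpha_m\cdots d\alpha_1 ,$$ where the innermost integral, over $[-1,1]$, is with respect to $\alpha_m$ and the outermost one, over $[-P^{m-1},P^{m-1}]$, is with respect to $\alpha_1$; that is, $|\alpha_j|\le P^{m-j}$ for $j=1,\dots,m$. Then there is a constant $D_\tau>0$, depending only on $m$ and $\tau$, such that for every positive integer $P$ and every real random variable $S$ $$I_k(P)\le D_\tau\,P^{2k-\Delta(\tau)}\Bigl(\sup_I \mathbf P(S\in I)\Bigr)^{2k},$$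 where the supremum is taken over all intervals $I=\{x: a<x\le a+1\}$ with $a$ real. Moreover, let $J_k(P)$ be the number of integer solutions of the system $\sum_{i=1}^k (x_i^j-y_i^j)=0$, $j=1,\dots,m$, with $1\le x_i,y_i\le P$. If $S$ is uniformly distributed on $\{1,\dots,P\}$, then $I_k(P)=2^m P^{-2k}J_k(P)$, and with the same constant $J_k(P)\le D_\tau P^{2k-\Delta(\tau)}$ for every positive integer $P$ (Vinogradov's bound with respect to $P$). -/

import Mathlib

open MeasureTheory

noncomputable section

namespace StochasticVinogradov

/-- The polynomial `f(x) = α_m x^m + ⋯ + α_1 x`. The coefficient `α_{j+1}` is the coordinate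
`α j`, for `j = 0, …, m - 1`. -/
def poly {m : ℕ} (α : Fin m → ℝ) (x : ℝ) : ℝ :=
  ∑ j : Fin m, α j * x ^ ((j : ℕ) + 1)

/-- The truncated characteristic functional `E exp{2πi f(S)} 1_{-P < S ≤ P}`. -/
def truncCharFun {Ω : Type*} [MeasurableSpace Ω] (μ : Measure Ω) (S : Ω → ℝ) (P : ℝ)
    {m : ℕ} (α : Fin m → ℝ) : ℂ :=
  ∫ ω, (S ⁻¹' Set.Ioc (-P) P).indicator
    (fun ω => Complex.exp (2 * Real.pi * Complex.I * (poly α (S ω) : ℂ))) ω ∂μ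

/-- The box of coefficients: `|α_i| ≤ P^{m-i}` for `i = 1, …, m`, so that `α_m` runs over
`[-1, 1]` (the innermost integral) and `α_1` over `[-P^{m-1}, P^{m-1}]` (the outermost one). -/
def coeffBox (m : ℕ) (P : ℝ) : Set (Fin m → ℝ) :=
  {α | ∀ j : Fin m, α j ∈ Set.Icc (-(P ^ (m - ((j : ℕ) + 1)))) (P ^ (m - ((j : ℕ) + 1)))}

/-- The normalized integral `I_k(P)`. -/
def meanValue {Ω : Type*} [MeasurableSpace Ω] (μ : Measure Ω) (S : Ω → ℝ)
    (m k : ℕ) (P : ℝ) : ℝ :=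
  P ^ (-(((m : ℝ) - 1) * (m : ℝ) / 2)) *
    ∫ α in coeffBox m P, ‖truncCharFun μ S P α‖ ^ (2 * k)

/-- The concentration function `sup_I P(S ∈ I)`, with `I` running over the intervals
`{x : a < x ≤ a + 1}`, `a` real. -/
def concentration {Ω : Type*} [MeasurableSpace Ω] (μ : Measure Ω) (S : Ω → ℝ) : ℝ :=
  ⨆ a : ℝ, μ.real (S ⁻¹' Set.Ioc a (a + 1))

/-- The exponent `Δ(τ) = m (m + 1) (1 - (1 - 1/m)^τ) / 2`. -/
def Delta (m τ : ℕ) : ℝ :=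
  (m : ℝ) * ((m : ℝ) + 1) * (1 - (1 - 1 / (m : ℝ)) ^ τ) / 2

/-- `J_k(P)`: the number of integer solutions of `∑_i (x_i^j - y_i^j) = 0`, `j = 1, …, m`,
with `1 ≤ x_i, y_i ≤ P` for `i = 1, …, k`. -/
def vinogradovCount (m k P : ℕ) : ℕ :=
  Set.ncard {p : (Fin k → ℤ) × (Fin k → ℤ) |
    (∀ i, 1 ≤ p.1 i ∧ p.1 i ≤ P) ∧ (∀ i, 1 ≤ p.2 i ∧ p.2 i ≤ P) ∧
    ∀ j : ℕ, 1 ≤ j → j ≤ m → ∑ i, (p.1 i ^ j - p.2 i ^ j) = 0}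

end StochasticVinogradov

end

open MeasureTheory

noncomputable section

namespace StochasticVinogradov

/-! The estimate is proved for every finite measure `ν` on `(c - P, c + P]` with mass at most 1 on
each unit interval (`UnitBounded`, `MeanBound`). The law of S, truncated and divided by its
concentration, is such a measure, and so is counting measure on {1, …, P}; hence one constant serves
both inequalities. The substitution α_j = P^{m-j} β_j turns I_k(P) into `curveMean`, a mean value
over the cube [-1, 1]^m.

Positivity is the basic tool. The 2k-th power of the modulus of a characteristic function is itself
the characteristic function of a difference of two sums of k points of the moment curve. Testing it
against weights with nonnegative Fourier transform shows that its mean over the cube is comparable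
with the product measure of the approximate solutions of the system, the equation of degree j
holding within about P^{j-m} (`integral_cube_le_measure`, `measure_le_integral_cube`). On
approximate solutions the centre and the scale can be changed at bounded cost; this is the
translation-dilation invariance of the system (`curveMean_le_curveMean`).

The step from q = mτ to m(τ + 1) cuts the interval into a constant number R of pieces. By
`broad_narrow`, either a single piece dominates, or m pairwise non-adjacent pieces are all large.
The first case is the same problem at scale P/R and is absorbed by an inner induction on the scale.
In the second, a factor raised to the power 2q is cut by convexity into n ≈ P^{1/m} shorter
intervals. Centre the system at one of these: its 2q variables contribute only O((P/n)^j) in degree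
j, so the 2m well-spaced variables satisfy the system with that tolerance. If m of them are fixed,
the other m lie in a set of measure O(n^{m(m-1)/2}) (`measure_pi_power_sums_le`), because power sums
determine well-spaced points stably (`abs_sub_le_of_power_sums`). The 2q short variables then cost a
mean value at scale P/n, to which the induction hypothesis applies.

The product n^{2q} P^m n^{m(m-1)/2} (P/n)^{2q-Δ(τ)} at n = P^{1/m} gives exactly the recursion Δ(τ +
1) = (m + 1)/2 + (1 - 1/m) Δ(τ) (`broad_exponent`, `Delta_succ`). -/

/-- The additive character `t ↦ exp (2πit)`. -/
def ee (t : ℝ) : ℂ := Complex.exp (2 * Real.pi * Complex.I * (t : ℂ))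

lemma ee_zero : ee 0 = 1 := by simp [ee]

lemma ee_add (s t : ℝ) : ee (s + t) = ee s * ee t := by
  simp only [ee, ← Complex.exp_add]
  congr 1
  push_cast
  ring

lemma ee_sum {ι : Type*} (s : Finset ι) (f : ι → ℝ) : ee (∑ i ∈ s, f i) = ∏ i ∈ s, ee (f i) := by
  classical
  induction s using Finset.induction_on with
  | empty => simp [ee_zero]
  | insert a s ha ih => rw [Finset.sum_insert ha, Finset.prod_insert ha, ee_add, ih]

lemma norm_ee (t : ℝ) : ‖ee t‖ = 1 := by
  rw [ee, show (2 * Real.pi * Complex.I * (t : ℂ)) = ((2 * Real.pi * t : ℝ) : ℂ) * Complex.I by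
    push_cast; ring]
  exact Complex.norm_exp_ofReal_mul_I _

lemma star_ee (t : ℝ) : (starRingEnd ℂ) (ee t) = ee (-t) := by
  rw [ee, ee, ← Complex.exp_conj]
  congr 1
  simp only [map_mul, Complex.conj_ofReal, Complex.conj_I, map_ofNat, Complex.ofReal_neg]
  ring

@[fun_prop]
lemma continuous_ee : Continuous ee := by
  unfold ee
  fun_prop

/-! ### The triangle function, its transform, and majorants and minorants of [-1, 1] -/

/-- The triangle function `max (0, 1 - |t|)`. -/
def tri (t : ℝ) : ℝ := max 0 (1 - |t|)

@[fun_prop]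
lemma continuous_tri : Continuous tri := by
  unfold tri
  fun_prop

lemma tri_nonneg (t : ℝ) : 0 ≤ tri t := le_max_left _ _

lemma tri_le_one (t : ℝ) : tri t ≤ 1 := max_le zero_le_one (by linarith [abs_nonneg t])

lemma tri_eq_zero {t : ℝ} (h : 1 ≤ |t|) : tri t = 0 := max_eq_left (by linarith)

lemma hasCompactSupport_tri : HasCompactSupport tri :=
  HasCompactSupport.of_support_subset_isCompact (isCompact_Icc (a := (-1 : ℝ)) (b := 1))
    fun t ht => by
      by_contra h
      apply ht
      apply tri_eq_zero
      by_contra h1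
      exact h (abs_le.mp (le_of_not_ge h1))

lemma integrable_tri : Integrable tri :=
  continuous_tri.integrable_of_hasCompactSupport hasCompactSupport_tri

lemma integral_one_sub_mul_exp {c : ℂ} (hc : c ≠ 0) :
    ∫ t in (0 : ℝ)..1, (1 - (t : ℂ)) * Complex.exp (c * t) = (Complex.exp c - 1 - c) / c ^ 2 := by
  have hd : ∀ t ∈ Set.uIcc (0 : ℝ) 1, HasDerivAt
      (fun t : ℝ => (1 - (t : ℂ)) * Complex.exp (c * t) / c + Complex.exp (c * t) / c ^ 2)
      ((1 - (t : ℂ)) * Complex.exp (c * t)) t := by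
    intro t _
    have h1 : HasDerivAt (fun t : ℝ => (t : ℂ)) 1 t := Complex.ofRealCLM.hasDerivAt
    have h2 : HasDerivAt (fun t : ℝ => Complex.exp (c * t)) (Complex.exp (c * t) * (c * 1)) t :=
      (h1.const_mul c).cexp
    have h3 := (((h1.const_sub 1).mul h2).div_const c).add (h2.div_const (c ^ 2))
    refine h3.congr_deriv ?_
    field_simp
    ring
  rw [intervalIntegral.integral_eq_sub_of_hasDerivAt hd
    (Continuous.intervalIntegrable (by fun_prop) _ _)]
  simp
  field_simp
  ring

/-- On each half of [-1, 1] the integrand is a linear function times an exponential. The two halves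
are reflections of each other, and their sum reduces to exp(c) + exp(-c) - 2 = -4 sin²(πu). -/
lemma integral_tri_mul_ee (u : ℝ) :
    ∫ t, (tri t : ℂ) * ee (t * u) = ((Real.sinc (Real.pi * u) ^ 2 : ℝ) : ℂ) := by
  have hsupp : Function.support (fun t => (tri t : ℂ) * ee (t * u)) ⊆ Set.Ioc (-1) 1 := by
    intro t ht
    by_contra h
    apply ht
    have : tri t = 0 := by
      apply tri_eq_zero
      by_contra h1
      push Not at h1
      rw [abs_lt] at h1
      exact h ⟨h1.1, h1.2.le⟩
    simp [this]
  have hint : ∀ a b, IntervalIntegrable (fun t => (tri t : ℂ) * ee (t * u)) volume a b :=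
    fun a b => Continuous.intervalIntegrable (by fun_prop) _ _
  rw [← intervalIntegral.integral_eq_integral_of_support_subset hsupp,
    ← intervalIntegral.integral_add_adjacent_intervals (hint (-1) 0) (hint 0 1)]
  set c : ℂ := 2 * Real.pi * Complex.I * u with hcdef
  have hA : ∫ t in (0 : ℝ)..1, (tri t : ℂ) * ee (t * u) =
      ∫ t in (0 : ℝ)..1, (1 - (t : ℂ)) * Complex.exp (c * t) := by
    refine intervalIntegral.integral_congr fun t ht => ?_
    rw [Set.uIcc_of_le zero_le_one] at ht
    have : tri t = 1 - t := by
      rw [tri, abs_of_nonneg ht.1, max_eq_right (by linarith [ht.2])]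
    simp only [this, ee]
    push_cast
    congr 2
    rw [hcdef]; ring
  have hB : ∫ t in (-1 : ℝ)..0, (tri t : ℂ) * ee (t * u) =
      ∫ t in (0 : ℝ)..1, (1 - (t : ℂ)) * Complex.exp (-c * t) := by
    have := intervalIntegral.integral_comp_neg (a := 0) (b := 1)
      (fun t : ℝ => (tri t : ℂ) * ee (t * u))
    rw [neg_zero] at this
    rw [← this]
    refine intervalIntegral.integral_congr fun t ht => ?_
    rw [Set.uIcc_of_le zero_le_one] at ht
    have : tri (-t) = 1 - t := by
      rw [tri, abs_neg, abs_of_nonneg ht.1, max_eq_right (by linarith [ht.2])]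
    simp only [this, ee]
    push_cast
    congr 2
    rw [hcdef]; ring
  rw [hA, hB]
  by_cases hu : u = 0
  · have hc : c = 0 := by simp [hcdef, hu]
    rw [hc, hu]
    have : ∫ t in (0 : ℝ)..1, (1 - (t : ℂ)) = 1 / 2 := by
      have : ∀ t : ℝ, (1 - (t : ℂ)) = ((1 - t : ℝ) : ℂ) := by intro t; push_cast; rfl
      simp_rw [this]
      rw [intervalIntegral.integral_ofReal, intervalIntegral.integral_sub (by simp) (by simp)]
      simp
      norm_num
    simp [this]
    norm_num
  · have hc : c ≠ 0 := by simp [hcdef, hu, Real.pi_ne_zero]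
    rw [integral_one_sub_mul_exp hc, integral_one_sub_mul_exp (neg_ne_zero.mpr hc),
      Real.sinc_of_ne_zero (by positivity)]
    have hcos : Complex.exp c + Complex.exp (-c) = 2 - 4 * Complex.sin (Real.pi * u) ^ 2 := by
      have h1 : c = (2 * (Real.pi * u) : ℂ) * Complex.I := by rw [hcdef]; ring
      rw [h1, ← neg_mul, ← Complex.two_cos, Complex.cos_two_mul, Complex.cos_sq']
      ring
    have hpu : (Real.pi * u : ℂ) ≠ 0 := by
      simp [hu, Real.pi_ne_zero]
    have hc2 : c ^ 2 = -4 * (Real.pi * u) ^ 2 := by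
      rw [hcdef]; ring_nf; simp
    push_cast
    rw [neg_sq, ← add_div, hc2, div_pow, div_eq_div_iff (by simpa using hpu) (by simpa using hpu)]
    linear_combination ((Real.pi : ℂ) * u) ^ 2 * hcos

lemma sinc_sq_le (u : ℝ) : Real.sinc (Real.pi * u) ^ 2 ≤ 2 * (1 + u ^ 2)⁻¹ := by
  have h1 : Real.sinc (Real.pi * u) ^ 2 ≤ 1 := by
    rw [sq_le_one_iff_abs_le_one]; exact Real.abs_sinc_le_one _
  by_cases hu : |u| ≤ 1
  · have : u ^ 2 ≤ 1 := by rwa [sq_le_one_iff_abs_le_one]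
    refine h1.trans ?_
    rw [← div_eq_mul_inv, le_div_iff₀ (by positivity)]
    linarith
  · push Not at hu
    have hu2 : 1 < u ^ 2 := by rwa [one_lt_sq_iff_one_lt_abs]
    have hu0 : u ≠ 0 := by rintro rfl; norm_num at hu2
    rw [Real.sinc_of_ne_zero (by positivity), div_pow]
    calc Real.sin (Real.pi * u) ^ 2 / (Real.pi * u) ^ 2 ≤ 1 / u ^ 2 := by
          apply div_le_div₀ zero_le_one (Real.sin_sq_le_one _) (by positivity)
          rw [mul_pow]
          have : 1 ≤ Real.pi ^ 2 := by nlinarith [Real.pi_gt_three]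
          nlinarith
      _ ≤ 2 * (1 + u ^ 2)⁻¹ := by
          rw [← div_eq_mul_inv, div_le_div_iff₀ (by positivity) (by positivity)]
          linarith

lemma integrable_sinc_sq : Integrable (fun u : ℝ => Real.sinc (Real.pi * u) ^ 2) := by
  refine (integrable_inv_one_add_sq.const_mul 2).mono' ?_ ?_
  · exact ((Real.continuous_sinc.comp (by fun_prop)).pow 2).aestronglyMeasurable
  · filter_upwards with u
    rw [Real.norm_of_nonneg (by positivity)]
    exact sinc_sq_le u

/-- Fourier inversion of `integral_tri_mul_ee`; the quadratic decay in `sinc_sq_le` supplies the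
integrability of the transform. -/
lemma integral_sinc_sq_mul_ee (t : ℝ) :
    ∫ u, ((Real.sinc (Real.pi * u) ^ 2 : ℝ) : ℂ) * ee (u * t) = (tri t : ℂ) := by
  have hF : ∀ w, FourierTransform.fourier (fun t => (tri t : ℂ)) w =
      ((Real.sinc (Real.pi * w) ^ 2 : ℝ) : ℂ) := by
    intro w
    rw [Real.fourier_real_eq_integral_exp_smul]
    have := integral_tri_mul_ee (-w)
    rw [mul_neg, Real.sinc_neg] at this
    rw [← this]
    congr 1
    ext v
    rw [smul_eq_mul, mul_comm, ee]
    congr 2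
    push_cast
    ring
  have h := Continuous.fourierInv_fourier_eq (f := fun t => (tri t : ℂ)) (by fun_prop)
    integrable_tri.ofReal (by rw [funext hF]; exact integrable_sinc_sq.ofReal)
  have h2 := congrFun h t
  rw [Real.fourierInv_eq'] at h2
  rw [← h2]
  congr 1
  ext v
  rw [smul_eq_mul, mul_comm, ee, hF]
  congr 2
  simp
  ring

/-- Jordan's inequality gives sin(πv) ≥ 2v on [0, 1/2], and π < 4. -/
lemma one_quarter_le_sinc_sq {u : ℝ} (hu : |u| ≤ 1 / 2) : 1 / 4 ≤ Real.sinc (Real.pi * u) ^ 2 := by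
  have key : ∀ v : ℝ, 0 ≤ v → v ≤ 1 / 2 → 1 / 4 ≤ Real.sinc (Real.pi * v) ^ 2 := by
    intro v hv0 hv
    rcases hv0.eq_or_lt with rfl | hpos
    · simp; norm_num
    have hp := Real.pi_pos
    have h1 := Real.mul_le_sin (x := Real.pi * v) (by positivity) (by nlinarith)
    have h2 : 1 / 2 ≤ Real.sinc (Real.pi * v) := by
      rw [Real.sinc_of_ne_zero (by positivity), le_div_iff₀ (by positivity)]
      have h3 : 2 / Real.pi * (Real.pi * v) = 2 * v := by field_simp
      rw [h3] at h1
      nlinarith [Real.pi_lt_four]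
    nlinarith
  rcases le_total 0 u with h | h
  · exact key u h (by rwa [abs_of_nonneg h] at hu)
  · have := key (-u) (by linarith) (by rwa [abs_of_nonpos h] at hu)
    rwa [mul_neg, Real.sinc_neg] at this

/-- A weight majorizing the indicator of `[-1, 1]` whose Fourier transform is nonnegative, bounded
and supported in `[-1, 1]`. -/
lemma exists_majorant : ∃ (w h : ℝ → ℝ), Continuous w ∧ Continuous h ∧ Integrable w ∧
    (∀ x, 0 ≤ w x) ∧ (∀ x, |x| ≤ 1 → 1 ≤ w x) ∧ (∀ t, 0 ≤ h t) ∧ (∀ t, h t ≤ 8) ∧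
    (∀ t, 1 ≤ |t| → h t = 0) ∧ ∀ t, ∫ x, (w x : ℂ) * ee (x * t) = (h t : ℂ) := by
  -- The argument is halved so that |x| ≤ 1 falls in the range of `one_quarter_le_sinc_sq`; the
  -- factor 4 then lifts the weight above 1. The transform picks up 4 · 2 = 8 and has support [-1/2,
  -- 1/2].
  refine ⟨fun x => 4 * Real.sinc (Real.pi * (x * (1 / 2))) ^ 2, fun t => 8 * tri (2 * t), ?_,
    by fun_prop, ?_, fun x => by positivity, ?_, ?_, ?_, ?_, ?_⟩
  · exact continuous_const.mul ((Real.continuous_sinc.comp (by fun_prop)).pow 2)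
  · exact (integrable_sinc_sq.comp_mul_right' (by norm_num)).const_mul 4
  · intro x hx
    have := one_quarter_le_sinc_sq (u := x * (1 / 2)) (by rw [abs_mul]; norm_num; linarith)
    linarith
  · intro t; have := tri_nonneg (2 * t); linarith
  · intro t; have := tri_le_one (2 * t); linarith
  · intro t ht
    have : tri (2 * t) = 0 := tri_eq_zero (by rw [abs_mul]; norm_num; linarith)
    simp [this]
  · intro t
    have h1 := integral_sinc_sq_mul_ee (2 * t)
    have h2 := Measure.integral_comp_mul_right
      (fun u => ((Real.sinc (Real.pi * u) ^ 2 : ℝ) : ℂ) * ee (u * (2 * t))) (1 / 2)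
    rw [h1] at h2
    have h3 : ∀ x : ℝ, ((4 * Real.sinc (Real.pi * (x * (1 / 2))) ^ 2 : ℝ) : ℂ) * ee (x * t) =
        4 * (((Real.sinc (Real.pi * (x * (1 / 2))) ^ 2 : ℝ) : ℂ) *
          ee (x * (1 / 2) * (2 * t))) := by
      intro x
      rw [show x * (1 / 2) * (2 * t) = x * t by ring]
      push_cast
      ring
    simp_rw [h3]
    rw [integral_const_mul, h2]
    norm_num
    ring

/-- A weight minorizing the indicator of `[-1, 1]` whose Fourier transform is nonnegative, and
bounded from below on `[-A, A]`. -/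
lemma exists_minorant {A : ℝ} (hA : 1 ≤ A) : ∃ (w h : ℝ → ℝ), Continuous w ∧ Continuous h ∧
    Integrable w ∧ (∀ x, 0 ≤ w x) ∧ (∀ x, w x ≤ 1) ∧ (∀ x, 1 < |x| → w x = 0) ∧
    (∀ t, 0 ≤ h t) ∧ (∀ t, |t| ≤ A → 1 ≤ (8 * A) * h t) ∧
    ∀ t, ∫ x, (w x : ℂ) * ee (x * t) = (h t : ℂ) := by
  have hA0 : 0 < A := by linarith
  -- Compressing the triangle by 2A stretches its transform, so that |t| ≤ A again falls in the
  -- range where sinc² ≥ 1/4; the value there is at least 1/(8A).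
  refine ⟨fun x => tri (x * (2 * A)),
    fun t => (2 * A)⁻¹ * Real.sinc (Real.pi * (t / (2 * A))) ^ 2, by fun_prop, ?_, ?_,
    fun x => tri_nonneg _, fun x => tri_le_one _, ?_, fun t => by positivity, ?_, ?_⟩
  · exact continuous_const.mul ((Real.continuous_sinc.comp (by fun_prop)).pow 2)
  · exact integrable_tri.comp_mul_right' (by positivity)
  · intro x hx
    apply tri_eq_zero
    rw [abs_mul, abs_of_pos (by positivity : 0 < 2 * A)]
    nlinarith
  · intro t ht
    have := one_quarter_le_sinc_sq (u := t / (2 * A)) (by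
      rw [abs_div, abs_of_pos (by positivity : 0 < 2 * A), div_le_div_iff₀ (by positivity)
        (by norm_num)]
      linarith)
    have h4 : 8 * A * ((2 * A)⁻¹ * Real.sinc (Real.pi * (t / (2 * A))) ^ 2) =
        4 * Real.sinc (Real.pi * (t / (2 * A))) ^ 2 := by
      generalize Real.sinc (Real.pi * (t / (2 * A))) = z
      field_simp
      ring
    rw [h4]
    linarith
  · intro t
    have h1 := integral_tri_mul_ee (t / (2 * A))
    have h2 := Measure.integral_comp_mul_right
      (fun u => (tri u : ℂ) * ee (u * (t / (2 * A)))) (2 * A)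
    rw [h1] at h2
    have h3 : ∀ x : ℝ, x * (2 * A) * (t / (2 * A)) = x * t := by
      intro x; field_simp
    simp_rw [h3] at h2
    rw [h2, abs_of_pos (by positivity), Complex.real_smul]
    push_cast
    ring

/-! ### Characteristic functions and the measure of approximate solutions -/

section CharacteristicFunctions

variable {Z Y : Type*} [MeasurableSpace Z] [MeasurableSpace Y] {m : ℕ}

/-- The characteristic function `β ↦ ∫ exp (2πi β·σ) dκ` of the map `σ` under the measure `κ`. -/
def cf (κ : Measure Z) (σ : Z → Fin m → ℝ) (β : Fin m → ℝ) : ℂ :=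
  ∫ ζ, ee (∑ j, β j * σ ζ j) ∂κ

/-- The cube `[-1, 1]^m`. -/
def cube (m : ℕ) : Set (Fin m → ℝ) := Set.Icc (fun _ => -1) (fun _ => 1)

lemma mem_cube {β : Fin m → ℝ} : β ∈ cube m ↔ ∀ j, |β j| ≤ 1 := by
  simp only [cube, Set.mem_Icc, Pi.le_def, abs_le, forall_and]

lemma measurableSet_cube : MeasurableSet (cube m) := measurableSet_Icc

lemma isCompact_cube : IsCompact (cube m) := isCompact_Icc

lemma volume_real_cube : volume.real (cube m) = 2 ^ m := by
  rw [Measure.real, cube, Real.volume_Icc_pi_toReal (fun _ => by norm_num)]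
  norm_num

lemma measurable_ee_sum {σ : Z → Fin m → ℝ} (hσ : Measurable σ) (β : Fin m → ℝ) :
    Measurable fun ζ => ee (∑ j, β j * σ ζ j) :=
  continuous_ee.measurable.comp
    (Finset.measurable_sum _ fun j _ => ((measurable_pi_apply j).comp hσ).const_mul (β j))

lemma integrable_ee_sum (κ : Measure Z) [IsFiniteMeasure κ] {σ : Z → Fin m → ℝ}
    (hσ : Measurable σ) (β : Fin m → ℝ) : Integrable (fun ζ => ee (∑ j, β j * σ ζ j)) κ :=
  (integrable_const (1 : ℝ)).mono' (measurable_ee_sum hσ β).aestronglyMeasurable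
    (ae_of_all _ fun _ => (norm_ee _).le)

lemma norm_cf_le (κ : Measure Z) [IsFiniteMeasure κ] (σ : Z → Fin m → ℝ) (β : Fin m → ℝ) :
    ‖cf κ σ β‖ ≤ κ.real Set.univ := by
  refine (norm_integral_le_of_norm_le_const (C := 1) (ae_of_all _ fun _ => (norm_ee _).le)).trans ?_
  rw [one_mul]

lemma continuous_cf (κ : Measure Z) [IsFiniteMeasure κ] {σ : Z → Fin m → ℝ} (hσ : Measurable σ) :
    Continuous (cf κ σ) := by
  refine continuous_of_dominated (bound := fun _ => 1)
    (fun β => (measurable_ee_sum hσ β).aestronglyMeasurable)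
    (fun β => ae_of_all _ fun ζ => (norm_ee _).le) (integrable_const _) ?_
  refine ae_of_all _ fun ζ => ?_
  fun_prop

lemma cf_prod (κ : Measure Z) (η : Measure Y) [SFinite κ] [SFinite η]
    (σ : Z → Fin m → ℝ) (ρ : Y → Fin m → ℝ) (β : Fin m → ℝ) :
    cf (κ.prod η) (fun z => σ z.1 + ρ z.2) β = cf κ σ β * cf η ρ β := by
  unfold cf
  rw [← integral_prod_mul]
  congr 1
  ext z
  rw [← ee_add, ← Finset.sum_add_distrib]
  simp only [Pi.add_apply, mul_add]

lemma cf_neg (κ : Measure Z) (σ : Z → Fin m → ℝ) (β : Fin m → ℝ) :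
    cf κ (fun z => -σ z) β = (starRingEnd ℂ) (cf κ σ β) := by
  unfold cf
  rw [← integral_conj]
  congr 1
  ext z
  rw [star_ee, ← Finset.sum_neg_distrib]
  simp only [Pi.neg_apply, mul_neg]

/-- Symmetrization: the difference of two independent copies has a nonnegative characteristic
function, which is what lets the cube be replaced by a smooth weight. -/
lemma cf_prod_self (κ : Measure Z) [SFinite κ] (σ : Z → Fin m → ℝ) (β : Fin m → ℝ) :
    cf (κ.prod κ) (fun z => σ z.1 - σ z.2) β = ((‖cf κ σ β‖ ^ 2 : ℝ) : ℂ) := by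
  have := cf_prod κ κ σ (fun z => -σ z) β
  rw [cf_neg, Complex.mul_conj, Complex.normSq_eq_norm_sq] at this
  simpa only [sub_eq_add_neg] using this

lemma cf_pi {ι : Type*} [Fintype ι] (ν : ι → Measure Z) [∀ i, SigmaFinite (ν i)]
    (γ : Z → Fin m → ℝ) (β : Fin m → ℝ) :
    cf (Measure.pi ν) (fun x => ∑ i, γ (x i)) β = ∏ i, cf (ν i) γ β := by
  unfold cf
  rw [← integral_fintype_prod_eq_prod]
  congr 1
  ext x
  rw [← ee_sum]
  congr 1
  simp only [Finset.sum_apply, Finset.mul_sum]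
  exact Finset.sum_comm

/-- Fubini (Parseval in disguise): a weight on the frequency side becomes its Fourier transform
evaluated at `σ`. -/
lemma integral_prod_mul_cf (κ : Measure Z) [IsFiniteMeasure κ] {σ : Z → Fin m → ℝ}
    (hσ : Measurable σ) {w : ℝ → ℝ} (hw : Integrable w) (hwc : Continuous w) {h : ℝ → ℝ}
    (hwh : ∀ t, ∫ x, (w x : ℂ) * ee (x * t) = (h t : ℂ)) :
    ∫ β : Fin m → ℝ, ((∏ j, w (β j) : ℝ) : ℂ) * cf κ σ β =
      ((∫ ζ, ∏ j, h (σ ζ j) ∂κ : ℝ) : ℂ) := by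
  have hswap : ∫ β : Fin m → ℝ, ∫ ζ, ((∏ j, w (β j) : ℝ) : ℂ) * ee (∑ j, β j * σ ζ j) ∂κ =
      ∫ ζ, (∫ β : Fin m → ℝ, ((∏ j, w (β j) : ℝ) : ℂ) * ee (∑ j, β j * σ ζ j)) ∂κ := by
    apply integral_integral_swap
    have hprod : Integrable (fun β : Fin m → ℝ => ∏ j, w (β j)) :=
      Integrable.fintype_prod (f := fun _ => w) (fun _ => hw)
    have h1 : Integrable (fun z : (Fin m → ℝ) × Z => (∏ j, w (z.1 j)) * (1 : ℝ))
        (volume.prod κ) := hprod.mul_prod (integrable_const 1)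
    refine h1.norm.mono' ?_ ?_
    · apply Measurable.aestronglyMeasurable
      unfold Function.uncurry
      refine Measurable.mul ?_ ?_
      · exact Complex.measurable_ofReal.comp (Finset.measurable_prod _ fun j _ =>
          hwc.measurable.comp ((measurable_pi_apply j).comp measurable_fst))
      · exact continuous_ee.measurable.comp (Finset.measurable_sum _ fun j _ =>
          ((measurable_pi_apply j).comp measurable_fst).mul
            ((measurable_pi_apply j).comp (hσ.comp measurable_snd)))
    · refine ae_of_all _ fun z => ?_
      simp only [Function.uncurry, norm_mul, norm_ee, mul_one]
      rw [Complex.norm_real]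
  simp only [cf, ← integral_const_mul]
  rw [hswap, ← integral_complex_ofReal]
  congr 1
  ext ζ
  have : ∀ β : Fin m → ℝ, ((∏ j, w (β j) : ℝ) : ℂ) * ee (∑ j, β j * σ ζ j) =
      ∏ j, ((w (β j) : ℂ) * ee (β j * σ ζ j)) := by
    intro β
    rw [ee_sum, Finset.prod_mul_distrib]
    push_cast
    rfl
  simp_rw [this]
  rw [integral_fintype_prod_volume_eq_prod (fun j x => (w x : ℂ) * ee (x * σ ζ j))]
  simp_rw [hwh]
  push_cast
  rfl

lemma measurableSet_abs_add_le {σ : Z → Fin m → ℝ} (hσ : Measurable σ) (u : Fin m → ℝ) (A : ℝ) :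
    MeasurableSet {ζ | ∀ j, |σ ζ j + u j| ≤ A} := by
  rw [Set.ofPred_forall]
  refine MeasurableSet.iInter fun j => ?_
  exact measurableSet_le (continuous_abs.measurable.comp
    (((measurable_pi_apply j).comp hσ).add_const _)) measurable_const

/-- If a characteristic function is nonnegative, then its mean value over the unit cube is
controlled by the measure of a neighbourhood of the origin. -/
lemma integral_cube_le_measure (κ : Measure Z) [IsFiniteMeasure κ] {σ : Z → Fin m → ℝ}
    (hσ : Measurable σ) {g : (Fin m → ℝ) → ℝ} (hg0 : ∀ β, 0 ≤ g β)
    (hg : ∀ β, cf κ σ β = (g β : ℂ)) :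
    ∫ β in cube m, g β ≤ 8 ^ m * κ.real {ζ | ∀ j, |σ ζ j| ≤ 1} := by
  obtain ⟨w, h, hwc, hhc, hw, hw0, hw1, hh0, hh8, hhs, hwh⟩ := exists_majorant
  have hgc : Continuous g := by
    have : g = fun β => (cf κ σ β).re := by ext β; rw [hg]; simp
    rw [this]
    exact Complex.continuous_re.comp (continuous_cf κ hσ)
  have hgb : ∀ β, g β ≤ κ.real Set.univ := by
    intro β
    have := norm_cf_le κ σ β
    rw [hg, Complex.norm_real, Real.norm_of_nonneg (hg0 β)] at this
    exact this
  have hprod : Integrable (fun β : Fin m → ℝ => ∏ j, w (β j)) :=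
    Integrable.fintype_prod (f := fun _ => w) (fun _ => hw)
  have hint : Integrable (fun β : Fin m → ℝ => (∏ j, w (β j)) * g β) := by
    refine hprod.mul_bdd (c := κ.real Set.univ) hgc.aestronglyMeasurable (ae_of_all _ fun β => ?_)
    rw [Real.norm_of_nonneg (hg0 β)]
    exact hgb β
  have hmain := integral_prod_mul_cf κ hσ hw hwc hwh
  simp_rw [hg, ← Complex.ofReal_mul] at hmain
  rw [integral_complex_ofReal] at hmain
  have hmain' := Complex.ofReal_injective hmain
  have hS : MeasurableSet {ζ | ∀ j, |σ ζ j| ≤ 1} := by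
    simpa using measurableSet_abs_add_le hσ 0 1
  have hI : Integrable ({ζ | ∀ j, |σ ζ j| ≤ 1}.indicator (fun _ => (8 : ℝ) ^ m)) κ :=
    (integrable_const _).indicator hS
  have hbound : ∀ ζ, ∏ j, h (σ ζ j) ≤ {ζ | ∀ j, |σ ζ j| ≤ 1}.indicator (fun _ => (8 : ℝ) ^ m) ζ := by
    intro ζ
    by_cases hz : ζ ∈ {ζ | ∀ j, |σ ζ j| ≤ 1}
    · rw [Set.indicator_of_mem hz]
      calc ∏ j, h (σ ζ j) ≤ ∏ _j : Fin m, (8 : ℝ) :=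
            Finset.prod_le_prod (fun j _ => hh0 _) (fun j _ => hh8 _)
        _ = 8 ^ m := by simp
    · rw [Set.indicator_of_notMem hz]
      simp only [Set.mem_ofPred_eq, not_forall, not_le] at hz
      obtain ⟨j, hj⟩ := hz
      exact (Finset.prod_eq_zero (Finset.mem_univ j) (hhs _ hj.le)).le
  calc ∫ β in cube m, g β ≤ ∫ β in cube m, (∏ j, w (β j)) * g β := by
        refine setIntegral_mono_on (hgc.continuousOn.integrableOn_compact isCompact_cube)
          hint.integrableOn measurableSet_cube fun β hβ => ?_
        rw [mem_cube] at hβ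
        exact le_mul_of_one_le_left (hg0 β) (Finset.one_le_prod fun j _ => hw1 _ (hβ j))
    _ ≤ ∫ β, (∏ j, w (β j)) * g β :=
        setIntegral_le_integral hint (ae_of_all _ fun β =>
          mul_nonneg (Finset.prod_nonneg fun j _ => hw0 _) (hg0 β))
    _ = ∫ ζ, ∏ j, h (σ ζ j) ∂κ := hmain'
    _ ≤ ∫ ζ, {ζ | ∀ j, |σ ζ j| ≤ 1}.indicator (fun _ => (8 : ℝ) ^ m) ζ ∂κ := by
        refine integral_mono (hI.mono' ?_ ?_) hI hbound
        · exact (Finset.measurable_prod _ fun j _ =>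
            hhc.measurable.comp ((measurable_pi_apply j).comp hσ)).aestronglyMeasurable
        · refine ae_of_all _ fun ζ => ?_
          rw [Real.norm_of_nonneg (Finset.prod_nonneg fun j _ => hh0 _)]
          exact hbound ζ
    _ = 8 ^ m * κ.real {ζ | ∀ j, |σ ζ j| ≤ 1} := by
        rw [integral_indicator_const _ hS, smul_eq_mul, mul_comm]

/-- The measure of a translate of a cube is controlled by the mean value of the characteristic
function. -/
lemma measure_le_integral_cube (κ : Measure Z) [IsFiniteMeasure κ] {σ : Z → Fin m → ℝ}
    (hσ : Measurable σ) (u : Fin m → ℝ) {A : ℝ} (hA : 1 ≤ A) :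
    κ.real {ζ | ∀ j, |σ ζ j + u j| ≤ A} ≤ (8 * A) ^ m * ∫ β in cube m, ‖cf κ σ β‖ := by
  obtain ⟨w, h, hwc, hhc, hw, hw0, hw1, hws, hh0, hhA, hwh⟩ := exists_minorant hA
  have hσu : Measurable fun ζ => σ ζ + u := hσ.add_const u
  -- A shift by `u` only multiplies the characteristic function by a unimodular factor, so the final
  -- bound is uniform in `u`.
  have hnorm : ∀ β, ‖cf κ (fun ζ => σ ζ + u) β‖ = ‖cf κ σ β‖ := by
    intro β
    have : cf κ (fun ζ => σ ζ + u) β = cf κ σ β * ee (∑ j, β j * u j) := by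
      unfold cf
      rw [← integral_mul_const]
      congr 1
      ext ζ
      rw [← ee_add, ← Finset.sum_add_distrib]
      simp only [Pi.add_apply, mul_add]
    rw [this, norm_mul, norm_ee, mul_one]
  have hmain := integral_prod_mul_cf κ hσu hw hwc hwh
  have hS := measurableSet_abs_add_le hσ u A
  set S := {ζ | ∀ j, |σ ζ j + u j| ≤ A} with hSdef
  have hmeas : Measurable fun ζ => ∏ j, h ((σ ζ + u) j) :=
    Finset.measurable_prod _ fun j _ => hhc.measurable.comp ((measurable_pi_apply j).comp hσu)
  have hhb : ∀ t, h t ≤ ∫ x, w x := by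
    intro t
    have h1 : ‖∫ x, (w x : ℂ) * ee (x * t)‖ ≤ ∫ x, ‖(w x : ℂ) * ee (x * t)‖ :=
      norm_integral_le_integral_norm _
    simp only [norm_mul, norm_ee, mul_one, Complex.norm_real] at h1
    rw [hwh, Complex.norm_real, Real.norm_of_nonneg (hh0 t)] at h1
    simpa only [Real.norm_of_nonneg (hw0 _)] using h1
  have hI : Integrable (fun ζ => ∏ j, h ((σ ζ + u) j)) κ := by
    refine (integrable_const ((∫ x, w x) ^ m)).mono' hmeas.aestronglyMeasurable ?_
    refine ae_of_all _ fun ζ => ?_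
    rw [Real.norm_of_nonneg (Finset.prod_nonneg fun j _ => hh0 _)]
    calc ∏ j, h ((σ ζ + u) j) ≤ ∏ _j : Fin m, ∫ x, w x :=
          Finset.prod_le_prod (fun j _ => hh0 _) (fun j _ => hhb _)
      _ = (∫ x, w x) ^ m := by simp
  have hind : ∀ ζ, S.indicator (fun _ => (1 : ℝ)) ζ ≤ (8 * A) ^ m * ∏ j, h ((σ ζ + u) j) := by
    intro ζ
    by_cases hz : ζ ∈ S
    · rw [Set.indicator_of_mem hz]
      have : (8 * A) ^ m * ∏ j, h ((σ ζ + u) j) = ∏ j, (8 * A) * h ((σ ζ + u) j) := by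
        rw [Finset.prod_mul_distrib]; simp
      rw [this]
      exact Finset.one_le_prod fun j _ => hhA _ (hz j)
    · rw [Set.indicator_of_notMem hz]
      exact mul_nonneg (by positivity) (Finset.prod_nonneg fun j _ => hh0 _)
  have hcfc : Continuous fun β => ‖cf κ σ β‖ := (continuous_cf κ hσ).norm
  have hfin : ‖∫ β : Fin m → ℝ, ((∏ j, w (β j) : ℝ) : ℂ) * cf κ (fun ζ => σ ζ + u) β‖ ≤
      ∫ β in cube m, ‖cf κ σ β‖ := by
    refine (norm_integral_le_integral_norm _).trans ?_
    rw [← integral_indicator measurableSet_cube]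
    have hle : ∀ β : Fin m → ℝ, ‖((∏ j, w (β j) : ℝ) : ℂ) * cf κ (fun ζ => σ ζ + u) β‖ ≤
        (cube m).indicator (fun β => ‖cf κ σ β‖) β := by
      intro β
      have hw0' : 0 ≤ ∏ j, w (β j) := Finset.prod_nonneg fun j _ => hw0 _
      rw [norm_mul, hnorm, Complex.norm_real, Real.norm_of_nonneg hw0']
      by_cases hb : β ∈ cube m
      · rw [Set.indicator_of_mem hb]
        exact mul_le_of_le_one_left (norm_nonneg _)
          (Finset.prod_le_one (fun j _ => hw0 _) fun j _ => hw1 _)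
      · rw [Set.indicator_of_notMem hb]
        rw [mem_cube] at hb
        push Not at hb
        obtain ⟨j, hj⟩ := hb
        rw [Finset.prod_eq_zero (Finset.mem_univ j) (hws _ hj), zero_mul]
    exact integral_mono_of_nonneg (ae_of_all _ fun β => norm_nonneg _)
      ((hcfc.continuousOn.integrableOn_compact isCompact_cube).integrable_indicator
        measurableSet_cube) (ae_of_all _ hle)
  rw [hmain, Complex.norm_real, Real.norm_of_nonneg
    (integral_nonneg fun ζ => Finset.prod_nonneg fun j _ => hh0 _)] at hfin
  calc κ.real S = ∫ ζ, S.indicator (fun _ => (1 : ℝ)) ζ ∂κ := by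
        rw [integral_indicator_const _ hS, smul_eq_mul, mul_one]
    _ ≤ ∫ ζ, (8 * A) ^ m * ∏ j, h ((σ ζ + u) j) ∂κ :=
        integral_mono ((integrable_const _).indicator hS) (hI.const_mul _) hind
    _ = (8 * A) ^ m * ∫ ζ, ∏ j, h ((σ ζ + u) j) ∂κ := integral_const_mul _ _
    _ ≤ (8 * A) ^ m * ∫ β in cube m, ‖cf κ σ β‖ :=
        mul_le_mul_of_nonneg_left hfin (by positivity)

end CharacteristicFunctions

/-! ### Stability of power sums for well-spaced points -/

/-- The polynomial that changes sign at `g i` whenever the sign pattern `ε` changes between `i` and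
`i + 1`. -/
def signPoly (ε g : ℕ → ℝ) (n : ℕ) : Polynomial ℝ :=
  ∏ i ∈ Finset.range n, if ε i = ε (i + 1) then 1 else Polynomial.C (g i) - Polynomial.X

lemma signPoly_succ (ε g : ℕ → ℝ) (n : ℕ) : signPoly ε g (n + 1) = signPoly ε g n *
    if ε n = ε (n + 1) then 1 else Polynomial.C (g n) - Polynomial.X :=
  Finset.prod_range_succ _ _

lemma natDegree_signPoly_le (ε g : ℕ → ℝ) (n : ℕ) : (signPoly ε g n).natDegree ≤ n := by
  induction n with
  | zero => simp [signPoly]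
  | succ n ih =>
    rw [signPoly_succ]
    refine Polynomial.natDegree_mul_le.trans (add_le_add ih ?_)
    split_ifs
    · simp
    · refine (Polynomial.natDegree_sub_le _ _).trans ?_
      simp

lemma abs_coeff_signPoly_le (ε g : ℕ → ℝ) {G : ℝ} (n : ℕ) (hg : ∀ i < n, |g i| ≤ G) (hG : 0 ≤ G)
    (j : ℕ) : |(signPoly ε g n).coeff j| ≤ (1 + G) ^ n := by
  induction n generalizing j with
  | zero =>
    simp only [signPoly, Finset.range_zero, Finset.prod_empty, Polynomial.coeff_one, pow_zero]
    split_ifs <;> simp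
  | succ n ih =>
    have ih' := ih fun i hi => hg i (by omega)
    have hle : (1 + G) ^ n ≤ (1 + G) ^ (n + 1) := pow_le_pow_right₀ (by linarith) (by omega)
    rw [signPoly_succ]
    split_ifs
    · rw [mul_one]
      exact (ih' j).trans hle
    · rw [mul_sub, Polynomial.coeff_sub, Polynomial.coeff_mul_C]
      have h1 : |(signPoly ε g n).coeff j * g n| ≤ (1 + G) ^ n * G := by
        rw [abs_mul]
        exact mul_le_mul (ih' j) (hg n (by omega)) (abs_nonneg _) (by positivity)
      have h2 : |(signPoly ε g n * Polynomial.X).coeff j| ≤ (1 + G) ^ n := by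
        cases j with
        | zero => simp; positivity
        | succ j => rw [Polynomial.coeff_mul_X]; exact ih' j
      calc _ ≤ |(signPoly ε g n).coeff j * g n| + |(signPoly ε g n * Polynomial.X).coeff j| :=
            abs_sub _ _
        _ ≤ (1 + G) ^ n * G + (1 + G) ^ n := add_le_add h1 h2
        _ = (1 + G) ^ (n + 1) := by ring

/-- On the `l`-th slot the factors with index at least `l` are positive, while those below `l` are
negative exactly where the pattern switches. The total sign is therefore `ε 0 * ε l`, and every
factor is at least `κ` in modulus. -/
lemma le_sign_mul_eval_signPoly (ε g : ℕ → ℝ) (hε : ∀ i, ε i = 1 ∨ ε i = -1) {κ : ℝ}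
    (hκ : 0 < κ) (hκ1 : κ ≤ 1) (n l : ℕ) (hl : l ≤ n) {u : ℝ}
    (h1 : ∀ i < l, g i + κ ≤ u) (h2 : ∀ i < n, l ≤ i → u ≤ g i - κ) :
    κ ^ n ≤ ε 0 * ε l * (signPoly ε g n).eval u := by
  induction n with
  | zero =>
    obtain rfl : l = 0 := by omega
    rcases hε 0 with h | h <;> simp [signPoly, h]
  | succ n ih =>
    rw [signPoly_succ, Polynomial.eval_mul]
    rcases hl.lt_or_eq with hlt | heq
    · have ih' := ih (by omega) fun i hi => h2 i (by omega)
      have hf : κ ≤ (if ε n = ε (n + 1) then (1 : Polynomial ℝ)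
          else Polynomial.C (g n) - Polynomial.X).eval u := by
        split_ifs
        · simpa using hκ1
        · have := h2 n (by omega) (by omega)
          simp
          linarith
      calc κ ^ (n + 1) = κ ^ n * κ := pow_succ _ _
        _ ≤ (ε 0 * ε l * (signPoly ε g n).eval u) * _ :=
            mul_le_mul ih' hf hκ.le ((pow_pos hκ n).le.trans ih')
        _ = _ := by ring
    · subst heq
      clear ih h2 hl
      -- all the sign changes lie to the left of `u`
      have key : ∀ k ≤ n + 1, κ ^ k ≤ ε 0 * ε k * (signPoly ε g k).eval u := by
        intro k hk
        induction k with
        | zero => rcases hε 0 with h | h <;> simp [signPoly, h]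
        | succ k ihk =>
          have ihk' := ihk (by omega)
          rw [signPoly_succ, Polynomial.eval_mul]
          have hf : κ ≤ ε k * ε (k + 1) * (if ε k = ε (k + 1) then (1 : Polynomial ℝ)
              else Polynomial.C (g k) - Polynomial.X).eval u := by
            have := h1 k (by omega)
            split_ifs with h
            · rw [← h]
              rcases hε k with h' | h' <;> simp [h'] <;> linarith
            · rcases hε k with h' | h' <;> rcases hε (k + 1) with h'' | h''
              · exact absurd (h'.trans h''.symm) h
              · simp [h', h'']; linarith
              · simp [h', h'']; linarith
              · exact absurd (h'.trans h''.symm) h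
          have hsq : ε k * ε k = 1 := by rcases hε k with h | h <;> simp [h]
          calc κ ^ (k + 1) = κ ^ k * κ := pow_succ _ _
            _ ≤ (ε 0 * ε k * (signPoly ε g k).eval u) * _ :=
                mul_le_mul ihk' hf hκ.le ((pow_pos hκ k).le.trans ihk')
            _ = (ε k * ε k) * (ε 0 * ε (k + 1) * ((signPoly ε g k).eval u *
                (if ε k = ε (k + 1) then (1 : Polynomial ℝ)
                  else Polynomial.C (g k) - Polynomial.X).eval u)) := by ring
            _ = _ := by rw [hsq, one_mul]
      have := key (n + 1) le_rfl
      rwa [signPoly_succ, Polynomial.eval_mul] at this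

/-- The point `u` may serve as the `l`-th of `m` points separated by `g 0, …, g (m - 2)`: it lies
above the `g i` with `i < l` and below the others, at distance at least `κ`. -/
def SeparatedBy {m : ℕ} (g : ℕ → ℝ) (κ : ℝ) (l : Fin m) (u : ℝ) : Prop :=
  (∀ i : ℕ, i < (l : ℕ) → g i + κ ≤ u) ∧ (∀ i : ℕ, i + 1 < m → (l : ℕ) ≤ i → u ≤ g i - κ)

/-- Power sums determine well-spaced points, in a quantitative form. -/
lemma abs_sub_le_of_power_sums {m : ℕ} {g : ℕ → ℝ} {κ G δ : ℝ} (hκ : 0 < κ) (hκ1 : κ ≤ 1)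
    (hG : 0 ≤ G) (hg : ∀ i, i + 1 < m → |g i| ≤ G) {y z : Fin m → ℝ}
    (hy : ∀ l, SeparatedBy g κ l (y l)) (hz : ∀ l, SeparatedBy g κ l (z l))
    (hδ : ∀ j : Fin m, |∑ l, y l ^ ((j : ℕ) + 1) - ∑ l, z l ^ ((j : ℕ) + 1)| ≤ δ) (l : Fin m) :
    κ ^ m * |y l - z l| ≤ m * (1 + G) ^ m * δ := by
  have hm : 0 < m := l.pos
  -- The sign pattern is that of `y l - z l`, so the polynomial below makes all the increments of
  -- its primitive have one common sign and nothing cancels in their sum. The value outside the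
  -- index range is immaterial.
  set ε : ℕ → ℝ := fun i => if h : i < m then (if z ⟨i, h⟩ ≤ y ⟨i, h⟩ then 1 else -1) else 1
    with hεdef
  have hε : ∀ i, ε i = 1 ∨ ε i = -1 := by
    intro i
    simp only [hεdef]
    split_ifs <;> simp
  have hεl : ∀ l : Fin m, ε l * (y l - z l) = |y l - z l| := by
    intro l
    simp only [hεdef, l.isLt, dif_pos, Fin.eta]
    split_ifs with h
    · rw [one_mul, abs_of_nonneg (by linarith)]
    · rw [abs_of_neg (by linarith)]; ring
  set Q := signPoly ε g (m - 1) with hQ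
  -- The primitive of `Q`, without constant term: summed over the points it is a combination of the
  -- power sums of degree 1 to m.
  set q : ℝ → ℝ := fun t => ∑ j : Fin m, Q.coeff j / ((j : ℕ) + 1) * t ^ ((j : ℕ) + 1) with hq
  have hdeg : Q.natDegree < m := by
    have : Q.natDegree ≤ m - 1 := natDegree_signPoly_le ε g (m - 1)
    omega
  have hderiv : ∀ t, HasDerivAt q (Q.eval t) t := by
    intro t
    rw [Polynomial.eval_eq_sum_range' hdeg, ← Fin.sum_univ_eq_sum_range
      (fun j => Q.coeff j * t ^ j)]
    refine HasDerivAt.fun_sum fun j _ => ?_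
    refine ((hasDerivAt_pow ((j : ℕ) + 1) t).const_mul _).congr_deriv ?_
    have : ((j : ℕ) : ℝ) + 1 ≠ 0 := by positivity
    field_simp
    push_cast
    simp
  have hlow : ∀ l : Fin m, κ ^ (m - 1) * |y l - z l| ≤ ε 0 * (q (y l) - q (z l)) := by
    intro l
    -- Mean value theorem: the slots are convex, so the intermediate point lies in slot `l`, where
    -- the sign and a lower bound of `Q` are known.
    have hmono : ∀ a b : ℝ, a < b → SeparatedBy g κ l a → SeparatedBy g κ l b →
        κ ^ (m - 1) * (b - a) ≤ ε 0 * ε l * (q b - q a) := by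
      intro a b hab ha hb
      obtain ⟨ξ, hξ, hξ2⟩ := exists_hasDerivAt_eq_slope q (fun t => Q.eval t) hab
        (fun t _ => (hderiv t).continuousAt.continuousWithinAt) (fun t _ => hderiv t)
      have h1 : q b - q a = Q.eval ξ * (b - a) := by
        rw [hξ2]
        field_simp [sub_ne_zero.mpr hab.ne']
      rw [h1, ← mul_assoc]
      refine mul_le_mul_of_nonneg_right ?_ (by linarith)
      refine le_sign_mul_eval_signPoly ε g hε hκ hκ1 (m - 1) l (by omega) ?_ ?_
      · intro i hi
        exact (ha.1 i hi).trans hξ.1.le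
      · intro i hi hli
        exact hξ.2.le.trans (hb.2 i (by omega) hli)
    rcases lt_trichotomy (z l) (y l) with h | h | h
    · have h1 := hmono _ _ h (hz l) (hy l)
      have h2 : ε l = 1 := by simp [hεdef, h.le]
      rw [h2, mul_one] at h1
      rwa [abs_of_pos (by linarith)]
    · simp [h]
    · have h1 := hmono _ _ h (hy l) (hz l)
      have h2 : ε l = -1 := by simp [hεdef, h]
      rw [h2] at h1
      rw [abs_of_neg (by linarith)]
      linarith
  have hsum : ∑ l, (q (y l) - q (z l)) = ∑ j : Fin m, Q.coeff j / ((j : ℕ) + 1) *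
      (∑ l, y l ^ ((j : ℕ) + 1) - ∑ l, z l ^ ((j : ℕ) + 1)) := by
    simp only [hq, ← Finset.sum_sub_distrib, Finset.mul_sum, ← mul_sub]
    exact Finset.sum_comm
  have hup : |∑ l, (q (y l) - q (z l))| ≤ m * ((1 + G) ^ m * δ) := by
    rw [hsum]
    refine (Finset.abs_sum_le_sum_abs _ _).trans ?_
    have : ∑ _j : Fin m, (1 + G) ^ m * δ = m * ((1 + G) ^ m * δ) := by simp
    rw [← this]
    refine Finset.sum_le_sum fun j _ => ?_
    rw [abs_mul]
    refine mul_le_mul ?_ (hδ j) (abs_nonneg _) (by positivity)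
    have hj : (1 : ℝ) ≤ ((j : ℕ) : ℝ) + 1 := by
      have : (0 : ℝ) ≤ ((j : ℕ) : ℝ) := by positivity
      linarith
    rw [abs_div, abs_of_pos (by linarith : (0 : ℝ) < ((j : ℕ) : ℝ) + 1)]
    calc _ ≤ |Q.coeff j| := div_le_self (abs_nonneg _) hj
      _ ≤ (1 + G) ^ (m - 1) :=
          abs_coeff_signPoly_le ε g (m - 1) (fun i hi => hg i (by omega)) hG j
      _ ≤ (1 + G) ^ m := pow_le_pow_right₀ (by linarith) (by omega)
  calc κ ^ m * |y l - z l| ≤ κ ^ (m - 1) * |y l - z l| :=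
        mul_le_mul_of_nonneg_right (pow_le_pow_of_le_one hκ.le hκ1 (by omega)) (abs_nonneg _)
    _ ≤ ∑ l, κ ^ (m - 1) * |y l - z l| :=
        Finset.single_le_sum (f := fun l => κ ^ (m - 1) * |y l - z l|)
          (fun l _ => by positivity) (Finset.mem_univ l)
    _ ≤ ∑ l, ε 0 * (q (y l) - q (z l)) := Finset.sum_le_sum fun l _ => hlow l
    _ = ε 0 * ∑ l, (q (y l) - q (z l)) := by rw [Finset.mul_sum]
    _ ≤ |ε 0 * ∑ l, (q (y l) - q (z l))| := le_abs_self _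
    _ = |∑ l, (q (y l) - q (z l))| := by
        rw [abs_mul]; rcases hε 0 with h | h <;> simp [h]
    _ ≤ m * (1 + G) ^ m * δ := by rw [mul_assoc]; exact hup

/-! ### Measures with bounded unit masses and prescribed power sums -/

/-- A measure on the line that gives mass at most `1` to each interval of length `1`. -/
def UnitBounded (ν : Measure ℝ) : Prop := ∀ a : ℝ, ν (Set.Ioc a (a + 1)) ≤ 1

lemma UnitBounded.restrict {ν : Measure ℝ} (h : UnitBounded ν) (s : Set ℝ) :
    UnitBounded (ν.restrict s) := fun a => (Measure.restrict_apply_le _ _).trans (h a)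

lemma UnitBounded.measure_Ioc_le {ν : Measure ℝ} (h : UnitBounded ν) (a : ℝ) (n : ℕ) :
    ν (Set.Ioc a (a + n)) ≤ n := by
  induction n with
  | zero => simp
  | succ n ih =>
    have : Set.Ioc a (a + (n + 1 : ℕ)) ⊆ Set.Ioc a (a + n) ∪ Set.Ioc (a + n) (a + n + 1) := by
      rw [Set.Ioc_union_Ioc_eq_Ioc (by simp) (by simp)]
      apply Set.Ioc_subset_Ioc_right
      push_cast
      linarith
    calc ν (Set.Ioc a (a + (n + 1 : ℕ))) ≤ ν (Set.Ioc a (a + n)) + ν (Set.Ioc (a + n) (a + n + 1)) :=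
          (measure_mono this).trans (measure_union_le _ _)
      _ ≤ n + 1 := add_le_add ih (h _)
      _ = (n + 1 : ℕ) := by push_cast; rfl

lemma UnitBounded.measure_Icc_le {ν : Measure ℝ} (h : UnitBounded ν) (a : ℝ) (M : ℕ) :
    ν (Set.Icc (a - M) (a + M)) ≤ (2 * M + 1 : ℕ) := by
  refine (measure_mono ?_).trans (h.measure_Ioc_le (a - M - 1) (2 * M + 1))
  intro x hx
  simp only [Set.mem_Icc, Set.mem_Ioc] at hx ⊢
  push_cast
  constructor <;> linarith [hx.1, hx.2]

/-- The number of well-spaced points whose power sums are prescribed with precision `H ^ j`, where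
`H = P / n` and `n` is about `P ^ (1 / m)`. -/
lemma measure_pi_power_sums_le (m : ℕ) {κ G B : ℝ} (hκ : 0 < κ) (hκ1 : κ ≤ 1) (hG : 0 ≤ G)
    (hB : 0 ≤ B) : ∃ C : ℕ, ∀ (P : ℝ) (n : ℕ) (g : ℕ → ℝ) (c : ℝ) (b : Fin m → ℝ)
      (ν : Fin m → Measure ℝ), 1 ≤ P → 1 ≤ n → P ≤ (2 * n) ^ m →
      (∀ i, i + 1 < m → |g i| ≤ G) → (∀ l, IsFiniteMeasure (ν l)) → (∀ l, UnitBounded (ν l)) →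
      (∀ l, ∀ᵐ x ∂(ν l), SeparatedBy g κ l ((x - c) / P)) →
      Measure.pi ν {x | ∀ j : Fin m, |∑ l, (x l - c) ^ ((j : ℕ) + 1) - b j| ≤
        B * (P / n) ^ ((j : ℕ) + 1)} ≤ (C * n ^ (∑ j : Fin m, (m - 1 - (j : ℕ))) : ℕ) := by
  -- `M` bounds how far each coordinate moves inside a cell, a set where every ⌊P · (normalized
  -- power sum)⌋ is constant, so that these sums vary by at most 1/P. `K` bounds the number of
  -- cells: P ≤ (2n)^m turns the allowed length 2BP/n^{j+1} into O(n^{m-1-j}), and the 2 in `2 * B +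
  -- 2` pays for rounding at both ends.
  obtain ⟨M, hM⟩ := exists_nat_ge (m * (1 + G) ^ m / κ ^ m)
  obtain ⟨K, hK⟩ := exists_nat_ge ((2 * B + 2) * 2 ^ m)
  refine ⟨K ^ m * (2 * M + 1) ^ m, fun P n g c b ν hP hn hPn hg hfin hν hsep => ?_⟩
  have hP0 : 0 < P := by linarith
  have hn0 : (0 : ℝ) < n := by exact_mod_cast hn
  -- the normalized power sums and their cells
  set s : Fin m → (Fin m → ℝ) → ℝ := fun j x => ∑ l, ((x l - c) / P) ^ ((j : ℕ) + 1) with hs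
  set S : Set (Fin m → ℝ) := {x | ∀ l, SeparatedBy g κ l ((x l - c) / P)} with hS
  set T : Set (Fin m → ℝ) := {x | ∀ j : Fin m, |∑ l, (x l - c) ^ ((j : ℕ) + 1) - b j| ≤
        B * (P / n) ^ ((j : ℕ) + 1)} with hT
  set lo : Fin m → ℝ := fun j => P * (b j / P ^ ((j : ℕ) + 1)) - B * P / n ^ ((j : ℕ) + 1) with hlo
  set hi : Fin m → ℝ := fun j => P * (b j / P ^ ((j : ℕ) + 1)) + B * P / n ^ ((j : ℕ) + 1) with hhi
  set V : Finset (Fin m → ℤ) := Fintype.piFinset fun j => Finset.Icc ⌊lo j⌋ ⌊hi j⌋ with hV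
  set cell : (Fin m → ℤ) → Set (Fin m → ℝ) := fun v => {x | x ∈ S ∧ ∀ j, ⌊P * s j x⌋ = v j}
    with hcell
  have hae : ∀ᵐ x ∂(Measure.pi ν), x ∈ S := by
    rw [hS]
    simp only [Set.mem_ofPred_eq]
    rw [ae_all_iff]
    intro l
    exact Measure.tendsto_eval_ae_ae.eventually (hsep l)
  have hcover : T ∩ S ⊆ ⋃ v ∈ V, cell v := by
    rintro x ⟨hxT, hxS⟩
    rw [Set.mem_iUnion₂]
    refine ⟨fun j => ⌊P * s j x⌋, ?_, hxS, fun j => rfl⟩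
    rw [hV, Fintype.mem_piFinset]
    intro j
    have h1 := hxT j
    have h2 : ∑ l, (x l - c) ^ ((j : ℕ) + 1) = P ^ ((j : ℕ) + 1) * s j x := by
      rw [hs, Finset.mul_sum]
      refine Finset.sum_congr rfl fun l _ => ?_
      rw [div_pow]
      field_simp
    rw [h2, abs_le] at h1
    have hp : 0 < P ^ ((j : ℕ) + 1) := by positivity
    have e1 : s j x - b j / P ^ ((j : ℕ) + 1) =
        (P ^ ((j : ℕ) + 1) * s j x - b j) / P ^ ((j : ℕ) + 1) := by field_simp
    have e2 : B * P / n ^ ((j : ℕ) + 1) =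
        P * (B * (P / n) ^ ((j : ℕ) + 1) / P ^ ((j : ℕ) + 1)) := by
      rw [div_pow]; field_simp
    rw [Finset.mem_Icc]
    constructor
    · apply Int.floor_mono
      rw [hlo]
      have : -(B * (P / n) ^ ((j : ℕ) + 1) / P ^ ((j : ℕ) + 1)) ≤
          s j x - b j / P ^ ((j : ℕ) + 1) := by
        rw [e1, ← neg_div]
        exact div_le_div_of_nonneg_right h1.1 hp.le
      have := mul_le_mul_of_nonneg_left this hP0.le
      simp only [e2]
      linarith
    · apply Int.floor_mono
      rw [hhi]
      have : s j x - b j / P ^ ((j : ℕ) + 1) ≤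
          B * (P / n) ^ ((j : ℕ) + 1) / P ^ ((j : ℕ) + 1) := by
        rw [e1]
        exact div_le_div_of_nonneg_right h1.2 hp.le
      have := mul_le_mul_of_nonneg_left this hP0.le
      simp only [e2]
      linarith
  have hcellm : ∀ v, Measure.pi ν (cell v) ≤ ((2 * M + 1) ^ m : ℕ) := by
    intro v
    rcases (cell v).eq_empty_or_nonempty with he | ⟨x, hx⟩
    · simp [he]
    have hsub : cell v ⊆ Set.univ.pi fun l => Set.Icc (x l - M) (x l + M) := by
      intro y hy l _
      have hδ : ∀ j : Fin m, |∑ l, ((y l - c) / P) ^ ((j : ℕ) + 1) -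
          ∑ l, ((x l - c) / P) ^ ((j : ℕ) + 1)| ≤ 1 / P := by
        intro j
        have h1 : ⌊P * s j y⌋ = ⌊P * s j x⌋ := (hy.2 j).trans (hx.2 j).symm
        have h2 := Int.abs_sub_lt_one_of_floor_eq_floor h1
        rw [← mul_sub, abs_mul, abs_of_pos hP0] at h2
        rw [le_div_iff₀ hP0]
        have : |s j y - s j x| * P ≤ 1 := by linarith
        exact this
      have h3 := abs_sub_le_of_power_sums hκ hκ1 hG hg hy.1 hx.1 hδ l
      have h4 : |(y l - c) / P - (x l - c) / P| = |y l - x l| / P := by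
        rw [← sub_div, abs_div, abs_of_pos hP0]
        congr 2
        ring
      rw [h4] at h3
      have h5 : |y l - x l| ≤ M := by
        refine le_trans ?_ hM
        rw [le_div_iff₀ (by positivity)]
        rw [mul_div_assoc', mul_one_div, div_le_div_iff_of_pos_right hP0] at h3
        linarith
      rw [abs_le] at h5
      constructor <;> linarith [h5.1, h5.2]
    calc Measure.pi ν (cell v) ≤ Measure.pi ν (Set.univ.pi fun l => Set.Icc (x l - M) (x l + M)) :=
          measure_mono hsub
      _ = ∏ l, ν l (Set.Icc (x l - M) (x l + M)) := Measure.pi_pi _ _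
      _ ≤ ∏ _l : Fin m, ((2 * M + 1 : ℕ) : ENNReal) :=
          Finset.prod_le_prod' fun l _ => (hν l).measure_Icc_le _ _
      _ = ((2 * M + 1) ^ m : ℕ) := by simp
  have hcard : V.card ≤ K ^ m * n ^ (∑ j : Fin m, (m - 1 - (j : ℕ))) := by
    rw [hV, Fintype.card_piFinset]
    have : K ^ m * n ^ (∑ j : Fin m, (m - 1 - (j : ℕ))) = ∏ j : Fin m, K * n ^ (m - 1 - (j : ℕ)) := by
      rw [Finset.prod_mul_distrib, Finset.prod_pow_eq_pow_sum]
      simp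
    rw [this]
    refine Finset.prod_le_prod' fun j _ => ?_
    rw [Int.card_Icc, Int.toNat_le]
    have h1 : (⌊hi j⌋ : ℝ) ≤ hi j := Int.floor_le _
    have h2 : lo j < ⌊lo j⌋ + 1 := Int.lt_floor_add_one _
    have hnp : (n : ℝ) ^ m = n ^ (m - 1 - (j : ℕ)) * n ^ ((j : ℕ) + 1) := by
      rw [← pow_add]; congr 1; omega
    have h3 : B * P / n ^ ((j : ℕ) + 1) ≤ B * 2 ^ m * n ^ (m - 1 - (j : ℕ)) := by
      rw [div_le_iff₀ (by positivity)]
      calc B * P ≤ B * (2 * n) ^ m := mul_le_mul_of_nonneg_left hPn hB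
        _ = _ := by rw [mul_pow, hnp]; ring
    have h4 : (1 : ℝ) ≤ n ^ (m - 1 - (j : ℕ)) := one_le_pow₀ (by exact_mod_cast hn)
    have h6 : (1 : ℝ) ≤ 2 ^ m := one_le_pow₀ (by norm_num)
    have h5 : (⌊hi j⌋ + 1 - ⌊lo j⌋ : ℝ) ≤ K * n ^ (m - 1 - (j : ℕ)) := by
      calc (⌊hi j⌋ + 1 - ⌊lo j⌋ : ℝ) ≤ hi j - lo j + 2 := by linarith
        _ = 2 * (B * P / n ^ ((j : ℕ) + 1)) + 2 := by rw [hhi, hlo]; ring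
        _ ≤ 2 * (B * 2 ^ m * n ^ (m - 1 - (j : ℕ))) + 2 * (2 ^ m * n ^ (m - 1 - (j : ℕ))) := by
            have := one_le_mul_of_one_le_of_one_le h6 h4
            linarith
        _ = (2 * B + 2) * 2 ^ m * n ^ (m - 1 - (j : ℕ)) := by ring
        _ ≤ K * n ^ (m - 1 - (j : ℕ)) := mul_le_mul_of_nonneg_right hK (by positivity)
    exact_mod_cast h5
  calc Measure.pi ν T ≤ Measure.pi ν (T ∩ S) := by
        refine measure_mono_ae ?_
        filter_upwards [hae] with x hx hxT
        exact ⟨hxT, hx⟩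
    _ ≤ Measure.pi ν (⋃ v ∈ V, cell v) := measure_mono hcover
    _ ≤ ∑ v ∈ V, Measure.pi ν (cell v) := measure_biUnion_finset_le _ _
    _ ≤ ∑ _v ∈ V, (((2 * M + 1) ^ m : ℕ) : ENNReal) := Finset.sum_le_sum fun v _ => hcellm v
    _ = (V.card * (2 * M + 1) ^ m : ℕ) := by simp
    _ ≤ _ := by
        rw [Nat.cast_le]
        calc V.card * (2 * M + 1) ^ m ≤
            (K ^ m * n ^ (∑ j : Fin m, (m - 1 - (j : ℕ)))) * (2 * M + 1) ^ m :=
              Nat.mul_le_mul_right _ hcard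
          _ = _ := by ring

/-! ### The moment curve: changes of centre and scale -/

/-- The moment curve centred at `c`, with the coordinates normalized at scale `P`. -/
def curve (m : ℕ) (P c x : ℝ) : Fin m → ℝ :=
  fun j => P ^ (m - 1 - (j : ℕ)) * (x - c) ^ ((j : ℕ) + 1)

lemma continuous_curve (m : ℕ) (P c : ℝ) : Continuous (curve m P c) := by
  unfold curve
  fun_prop

/-- The mean value of order `2q` of the characteristic function of the moment curve. -/
def curveMean (m q : ℕ) (P c : ℝ) (ν : Measure ℝ) : ℝ :=
  ∫ β in cube m, ‖cf ν (curve m P c) β‖ ^ (2 * q)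

lemma curveMean_nonneg (m q : ℕ) (P c : ℝ) (ν : Measure ℝ) : 0 ≤ curveMean m q P c ν :=
  integral_nonneg fun _ => by positivity

/-- The difference of two sums of points of the moment curve. -/
def curveDiff {ι : Type*} [Fintype ι] (m : ℕ) (P c : ℝ) (z : (ι → ℝ) × (ι → ℝ)) : Fin m → ℝ :=
  ∑ i, curve m P c (z.1 i) - ∑ i, curve m P c (z.2 i)

lemma curveDiff_apply {ι : Type*} [Fintype ι] (m : ℕ) (P c : ℝ) (z : (ι → ℝ) × (ι → ℝ))
    (j : Fin m) : curveDiff m P c z j = P ^ (m - 1 - (j : ℕ)) *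
      (∑ i, (z.1 i - c) ^ ((j : ℕ) + 1) - ∑ i, (z.2 i - c) ^ ((j : ℕ) + 1)) := by
  simp only [curveDiff, curve, Pi.sub_apply, Finset.sum_apply, mul_sub, Finset.mul_sum]

lemma continuous_curveDiff {ι : Type*} [Fintype ι] (m : ℕ) (P c : ℝ) :
    Continuous (curveDiff (ι := ι) m P c) := by
  have := continuous_curve m P c
  unfold curveDiff
  fun_prop

lemma cf_curveDiff {ι : Type*} [Fintype ι] (m : ℕ) (P c : ℝ) (ν : ι → Measure ℝ)
    [∀ i, IsFiniteMeasure (ν i)] (β : Fin m → ℝ) :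
    cf ((Measure.pi ν).prod (Measure.pi ν)) (curveDiff m P c) β =
      ((∏ i, ‖cf (ν i) (curve m P c) β‖ ^ 2 : ℝ) : ℂ) := by
  have := cf_prod_self (Measure.pi ν) (fun x => ∑ i, curve m P c (x i)) β
  rw [cf_pi, norm_prod, ← Finset.prod_pow] at this
  exact this

lemma cf_curveDiff_const (m q : ℕ) (P c : ℝ) (η : Measure ℝ) [IsFiniteMeasure η]
    (β : Fin m → ℝ) :
    cf ((Measure.pi fun _ : Fin q => η).prod (Measure.pi fun _ : Fin q => η))
      (curveDiff m P c) β = ((‖cf η (curve m P c) β‖ ^ (2 * q) : ℝ) : ℂ) := by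
  rw [cf_curveDiff, Finset.prod_const, Finset.card_univ, Fintype.card_fin, pow_mul]

/-- A translation of the centre distorts the normalized power sums by a bounded factor. -/
lemma translate_power_sums_le {ι : Type*} [Fintype ι] {m : ℕ} {P A c c' : ℝ} (hP : 0 < P)
    (hc : |c - c'| ≤ P) (ε x : ι → ℝ) (hε : ∑ i, ε i = 0)
    (h : ∀ j : Fin m, |P ^ (m - 1 - (j : ℕ)) * ∑ i, ε i * (x i - c) ^ ((j : ℕ) + 1)| ≤ A)
    (j : Fin m) : |P ^ (m - 1 - (j : ℕ)) * ∑ i, ε i * (x i - c') ^ ((j : ℕ) + 1)| ≤ 2 ^ m * A := by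
  have hA : 0 ≤ A := (abs_nonneg _).trans (h j)
  have hexp : P ^ (m - 1 - (j : ℕ)) * ∑ i, ε i * (x i - c') ^ ((j : ℕ) + 1) =
      ∑ r ∈ Finset.range ((j : ℕ) + 2), P ^ (m - 1 - (j : ℕ)) *
        ((∑ i, ε i * (x i - c) ^ r) * ((c - c') ^ ((j : ℕ) + 1 - r) * ((j : ℕ) + 1).choose r)) := by
    rw [← Finset.mul_sum]
    congr 1
    simp only [Finset.sum_mul]
    rw [Finset.sum_comm]
    refine Finset.sum_congr rfl fun i _ => ?_
    rw [show x i - c' = (x i - c) + (c - c') by ring, add_pow, Finset.mul_sum]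
    refine Finset.sum_congr rfl fun r _ => ?_
    ring
  rw [hexp]
  refine (Finset.abs_sum_le_sum_abs _ _).trans ?_
  have hterm : ∀ r ∈ Finset.range ((j : ℕ) + 2), |P ^ (m - 1 - (j : ℕ)) *
        ((∑ i, ε i * (x i - c) ^ r) * ((c - c') ^ ((j : ℕ) + 1 - r) * ((j : ℕ) + 1).choose r))| ≤
      ((j : ℕ) + 1).choose r * A := by
    intro r hr
    rw [Finset.mem_range] at hr
    -- The degree 0 term vanishes because the weights sum to zero; this is why the system is
    -- invariant under translation.
    rcases r with _ | r
    · simp [hε, hA]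
    · have h1 := h ⟨r, by omega⟩
      simp only at h1
      have hpow : P ^ (m - 1 - r) = P ^ (m - 1 - (j : ℕ)) * P ^ ((j : ℕ) + 1 - (r + 1)) := by
        rw [← pow_add]; congr 1; omega
      rw [hpow] at h1
      have hcc : |(c - c') ^ ((j : ℕ) + 1 - (r + 1))| ≤ P ^ ((j : ℕ) + 1 - (r + 1)) := by
        rw [abs_pow]; exact pow_le_pow_left₀ (abs_nonneg _) hc _
      have hch : |(((j : ℕ) + 1).choose (r + 1) : ℝ)| = ((j : ℕ) + 1).choose (r + 1) :=
        abs_of_nonneg (by positivity)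
      have hPp : |P ^ (m - 1 - (j : ℕ))| = P ^ (m - 1 - (j : ℕ)) := abs_of_pos (by positivity)
      have hPp' : |P ^ ((j : ℕ) + 1 - (r + 1))| = P ^ ((j : ℕ) + 1 - (r + 1)) :=
        abs_of_pos (by positivity)
      rw [abs_mul, abs_mul, hPp, hPp'] at h1
      rw [abs_mul, abs_mul, abs_mul, hPp, hch]
      calc P ^ (m - 1 - (j : ℕ)) * (|∑ i, ε i * (x i - c) ^ (r + 1)| *
            (|(c - c') ^ ((j : ℕ) + 1 - (r + 1))| * ((j : ℕ) + 1).choose (r + 1)))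
          ≤ P ^ (m - 1 - (j : ℕ)) * (|∑ i, ε i * (x i - c) ^ (r + 1)| *
            (P ^ ((j : ℕ) + 1 - (r + 1)) * ((j : ℕ) + 1).choose (r + 1))) := by gcongr
        _ = ((j : ℕ) + 1).choose (r + 1) * (P ^ (m - 1 - (j : ℕ)) *
            P ^ ((j : ℕ) + 1 - (r + 1)) * |∑ i, ε i * (x i - c) ^ (r + 1)|) := by ring
        _ ≤ _ := by gcongr
  refine (Finset.sum_le_sum hterm).trans ?_
  rw [← Finset.sum_mul]
  have hs := Nat.sum_range_choose ((j : ℕ) + 1)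
  have hs' : ∑ r ∈ Finset.range ((j : ℕ) + 2), (((j : ℕ) + 1).choose r : ℝ) = 2 ^ ((j : ℕ) + 1) := by
    exact_mod_cast hs
  rw [hs']
  exact mul_le_mul_of_nonneg_right (pow_le_pow_right₀ (by norm_num) (by omega)) hA

lemma translate_curveDiff_le {ι : Type*} [Fintype ι] {m : ℕ} {P c c' A : ℝ} (hP : 0 < P)
    (hc : |c - c'| ≤ P) {z : (ι → ℝ) × (ι → ℝ)} (h : ∀ j, |curveDiff m P c z j| ≤ A) (j : Fin m) :
    |curveDiff m P c' z j| ≤ 2 ^ m * A := by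
  have := translate_power_sums_le (ι := ι ⊕ ι) hP hc (Sum.elim 1 (-1)) (Sum.elim z.1 z.2)
    (by simp) (m := m) (A := A) (fun j => by
      have := h j
      rw [curveDiff_apply] at this
      simpa [Fintype.sum_sum_type, sub_eq_add_neg] using this) j
  rw [curveDiff_apply]
  simpa [Fintype.sum_sum_type, sub_eq_add_neg] using this

/-- Only the total of the two differences is small, so both families must be recentred together, as
one family indexed by the disjoint union. -/
lemma translate_curveDiff_add_le {ι ι' : Type*} [Fintype ι] [Fintype ι'] {m : ℕ} {P c c' A : ℝ}
    (hP : 0 < P) (hc : |c - c'| ≤ P) {z : (ι → ℝ) × (ι → ℝ)} {w : (ι' → ℝ) × (ι' → ℝ)}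
    (h : ∀ j, |curveDiff m P c z j + curveDiff m P c w j| ≤ A) (j : Fin m) :
    |curveDiff m P c' z j + curveDiff m P c' w j| ≤ 2 ^ m * A := by
  have := translate_curveDiff_le (ι := ι ⊕ ι') hP hc (m := m) (A := A)
    (z := (Sum.elim z.1 w.1, Sum.elim z.2 w.2)) (fun j => by
      have := h j
      simp only [curveDiff_apply, Fintype.sum_sum_type, Sum.elim_inl, Sum.elim_inr] at this ⊢
      convert this using 2
      ring) j
  simp only [curveDiff_apply, Fintype.sum_sum_type, Sum.elim_inl, Sum.elim_inr] at this ⊢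
  convert this using 2
  ring

/-- Lowering the scale multiplies coordinate `j` by (P'/P)^{m-1-j} ≤ 1, so approximate solutions at
scale `P` remain so at scale `P'` once the shift is rescaled too; the bound of
`measure_le_integral_cube` does not depend on the shift. -/
lemma measure_curveDiff_add_le (m q : ℕ) {P P' : ℝ} (c : ℝ) (hP' : 0 < P') (hPP : P' ≤ P)
    (η : Measure ℝ) [IsFiniteMeasure η] (u : Fin m → ℝ) {A : ℝ} (hA : 1 ≤ A) :
    ((Measure.pi fun _ : Fin q => η).prod (Measure.pi fun _ : Fin q => η)).real
      {z | ∀ j, |curveDiff m P c z j + u j| ≤ A} ≤ (8 * A) ^ m * curveMean m q P' c η := by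
  have hP : 0 < P := hP'.trans_le hPP
  have key := measure_le_integral_cube
    ((Measure.pi fun _ : Fin q => η).prod (Measure.pi fun _ : Fin q => η))
    (continuous_curveDiff m P' c).measurable
    (fun j => (P' / P) ^ (m - 1 - (j : ℕ)) * u j) hA
  simp only [cf_curveDiff_const, Complex.norm_real] at key
  refine le_trans (measureReal_mono ?_) (key.trans (le_of_eq ?_))
  · intro z hz j
    have h1 := hz j
    have h2 : curveDiff m P' c z j + (P' / P) ^ (m - 1 - (j : ℕ)) * u j =
        (P' / P) ^ (m - 1 - (j : ℕ)) * (curveDiff m P c z j + u j) := by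
      rw [curveDiff_apply, curveDiff_apply, div_pow]
      field_simp
    rw [h2, abs_mul, abs_of_pos (by positivity)]
    calc _ ≤ 1 * |curveDiff m P c z j + u j| := by
          gcongr
          exact pow_le_one₀ (by positivity) ((div_le_one hP).mpr hPP)
      _ ≤ A := by rwa [one_mul]
  · congr 1
    refine setIntegral_congr_fun measurableSet_cube fun β _ => ?_
    exact Real.norm_of_nonneg (by positivity)

/-- Passing to a smaller scale and a nearby centre. -/
lemma curveMean_le_curveMean (m k : ℕ) {P P' c c' : ℝ} (hP' : 0 < P') (hPP : P' ≤ P)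
    (hc : |c - c'| ≤ P) (η : Measure ℝ) [IsFiniteMeasure η] :
    curveMean m k P c η ≤ 8 ^ m * (8 * 2 ^ m) ^ m * curveMean m k P' c' η := by
  have hP : 0 < P := hP'.trans_le hPP
  have h1 := integral_cube_le_measure
    ((Measure.pi fun _ : Fin k => η).prod (Measure.pi fun _ : Fin k => η))
    (continuous_curveDiff m P c).measurable (fun β => by positivity)
    (fun β => cf_curveDiff_const m k P c η β)
  have h2 := measure_curveDiff_add_le m k c' hP' hPP η 0 (A := 2 ^ m) (one_le_pow₀ (by norm_num))
  have h3 : ((Measure.pi fun _ : Fin k => η).prod (Measure.pi fun _ : Fin k => η)).real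
      {z | ∀ j, |curveDiff m P c z j| ≤ 1} ≤
      ((Measure.pi fun _ : Fin k => η).prod (Measure.pi fun _ : Fin k => η)).real
      {z | ∀ j, |curveDiff m P c' z j + (0 : Fin m → ℝ) j| ≤ 2 ^ m} := by
    refine measureReal_mono fun z hz j => ?_
    have := translate_curveDiff_le hP hc hz j
    simpa using this
  calc curveMean m k P c η ≤ _ := h1
    _ ≤ 8 ^ m * ((8 * 2 ^ m) ^ m * curveMean m k P' c' η) := by
        gcongr
        exact h3.trans h2
    _ = _ := by ring

lemma curveDiff_const_abs_le {q : ℕ} {H c : ℝ} {z : (Fin q → ℝ) × (Fin q → ℝ)}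
    (h1 : ∀ i, |z.1 i - c| ≤ H) (h2 : ∀ i, |z.2 i - c| ≤ H) (r : ℕ) :
    |∑ i, (z.1 i - c) ^ r - ∑ i, (z.2 i - c) ^ r| ≤ 2 * q * H ^ r := by
  have hb : ∀ y : Fin q → ℝ, (∀ i, |y i - c| ≤ H) → |∑ i, (y i - c) ^ r| ≤ q * H ^ r := by
    intro y hy
    calc |∑ i, (y i - c) ^ r| ≤ ∑ i, |(y i - c) ^ r| := Finset.abs_sum_le_sum_abs _ _
      _ ≤ ∑ _i : Fin q, H ^ r := Finset.sum_le_sum fun i _ => by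
          rw [abs_pow]; exact pow_le_pow_left₀ (abs_nonneg _) (hy i) _
      _ = q * H ^ r := by simp
  calc _ ≤ |∑ i, (z.1 i - c) ^ r| + |∑ i, (z.2 i - c) ^ r| := abs_sub _ _
    _ ≤ q * H ^ r + q * H ^ r := add_le_add (hb _ h1) (hb _ h2)
    _ = _ := by ring

/-! ### The well-spaced mean value estimate -/

/-- The mean value of a product of `m` well-spaced short characteristic functions and of a power
of one supported in a much shorter interval. -/
lemma integral_prod_mul_le (m q : ℕ) {κ G : ℝ} (hκ : 0 < κ) (hκ1 : κ ≤ 1) (hG : 0 ≤ G) :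
    ∃ C : ℝ, 0 < C ∧ ∀ (P : ℝ) (n N : ℕ) (g : ℕ → ℝ) (c c' : ℝ) (ν : Fin m → Measure ℝ)
      (η : Measure ℝ), 1 ≤ P → 1 ≤ n → (n : ℝ) ≤ P → P ≤ (2 * n) ^ m →
      (∀ i, i + 1 < m → |g i| ≤ G) → |c - c'| ≤ P →
      (∀ l, IsFiniteMeasure (ν l)) → IsFiniteMeasure η →
      (∀ l, UnitBounded (ν l)) → (∀ l, ν l Set.univ ≤ N) →
      (∀ l, ∀ᵐ x ∂(ν l), SeparatedBy g κ l ((x - c') / P)) → (∀ᵐ x ∂η, |x - c'| ≤ P / n) →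
      ∫ β in cube m, (∏ l, ‖cf (ν l) (curve m P c) β‖ ^ 2) *
          ‖cf η (curve m P c) β‖ ^ (2 * q) ≤
        C * N ^ m * n ^ (∑ j : Fin m, (m - 1 - (j : ℕ))) * curveMean m q (P / n) c' η := by
  -- The tolerance for the well-spaced variables: 2^m is the cost of recentring at `c'`, and 2q
  -- bounds the contribution of the variables of `η`, in units of (P/n)^{j+1}.
  set B : ℝ := 2 ^ m + 2 * q with hB
  obtain ⟨C₀, hC₀⟩ := measure_pi_power_sums_le m (B := B) hκ hκ1 hG (by positivity)
  refine ⟨8 ^ m * (8 * 2 ^ m) ^ m * (C₀ + 1), by positivity, ?_⟩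
  intro P n N g c c' ν η hP hn hnP hPn hg hc hνf hηf hν hνN hsep hη
  have hP0 : 0 < P := by linarith
  have hn0 : (0 : ℝ) < n := by exact_mod_cast hn
  have hH : 1 ≤ P / n := by rwa [one_le_div hn0]
  have hHP : P / n ≤ P := div_le_self hP0.le (by exact_mod_cast hn)
  set κ₁ := (Measure.pi ν).prod (Measure.pi ν) with hκ₁
  set κ₂ := (Measure.pi fun _ : Fin q => η).prod (Measure.pi fun _ : Fin q => η) with hκ₂
  set σ : ((Fin m → ℝ) × (Fin m → ℝ)) × ((Fin q → ℝ) × (Fin q → ℝ)) → Fin m → ℝ :=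
    fun z => curveDiff m P c z.1 + curveDiff m P c z.2 with hσ
  have hσm : Measurable σ := by
    have h1 := (continuous_curveDiff (ι := Fin m) m P c).measurable
    have h2 := (continuous_curveDiff (ι := Fin q) m P c).measurable
    exact (h1.comp measurable_fst).add (h2.comp measurable_snd)
  have hcf : ∀ β, cf (κ₁.prod κ₂) σ β = (((∏ l, ‖cf (ν l) (curve m P c) β‖ ^ 2) *
          ‖cf η (curve m P c) β‖ ^ (2 * q) : ℝ) : ℂ) := by
    intro β
    rw [hσ, cf_prod, cf_curveDiff, cf_curveDiff_const]
    push_cast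
    rfl
  have hup := integral_cube_le_measure (κ₁.prod κ₂) hσm (fun β => by positivity) hcf
  -- the localization of the well-spaced variables
  set T : Set ((Fin m → ℝ) × (Fin m → ℝ)) := {z | ∀ j : Fin m,
    |∑ l, (z.1 l - c') ^ ((j : ℕ) + 1) - ∑ l, (z.2 l - c') ^ ((j : ℕ) + 1)| ≤
      B * (P / n) ^ ((j : ℕ) + 1)} with hT
  have hTm : MeasurableSet T := by
    rw [hT, Set.ofPred_forall]
    refine MeasurableSet.iInter fun j => ?_
    refine measurableSet_le (Continuous.measurable ?_) measurable_const
    fun_prop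
  set E : Set (((Fin m → ℝ) × (Fin m → ℝ)) × ((Fin q → ℝ) × (Fin q → ℝ))) :=
    {z | z.1 ∈ T ∧ ∀ j, |curveDiff m P c' z.1 j + curveDiff m P c' z.2 j| ≤ 2 ^ m} with hE
  have hEm : MeasurableSet E := by
    have hEeq : E = Prod.fst ⁻¹' T ∩
        ⋂ j, {z | |curveDiff m P c' z.1 j + curveDiff m P c' z.2 j| ≤ 2 ^ m} := by
      ext z
      simp [hE]
    rw [hEeq]
    refine (measurable_fst hTm).inter ?_
    refine MeasurableSet.iInter fun j => ?_
    refine measurableSet_le (Continuous.measurable ?_) measurable_const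
    have h1 := continuous_curveDiff (ι := Fin m) m P c'
    have h2 := continuous_curveDiff (ι := Fin q) m P c'
    fun_prop
  have hηpi : ∀ᵐ y ∂(Measure.pi fun _ : Fin q => η), ∀ i, |y i - c'| ≤ P / n := by
    rw [ae_all_iff]
    intro i
    exact (Measure.tendsto_eval_ae_ae (μ := fun _ : Fin q => η) (i := i)).eventually hη
  have hae : ∀ᵐ z ∂(κ₁.prod κ₂), (∀ i, |z.2.1 i - c'| ≤ P / n) ∧ ∀ i, |z.2.2 i - c'| ≤ P / n := by
    have h2 : ∀ᵐ w ∂κ₂, (∀ i, |w.1 i - c'| ≤ P / n) ∧ ∀ i, |w.2 i - c'| ≤ P / n :=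
      (Measure.quasiMeasurePreserving_fst.ae hηpi).and (Measure.quasiMeasurePreserving_snd.ae hηpi)
    exact Measure.quasiMeasurePreserving_snd.ae h2
  have hsub : (κ₁.prod κ₂) {z | ∀ j, |σ z j| ≤ 1} ≤ (κ₁.prod κ₂) E := by
    refine measure_mono_ae ?_
    filter_upwards [hae] with z hz hzS
    have htr := translate_curveDiff_add_le hP0 hc (z := z.1) (w := z.2) (m := m) (A := 1) hzS
    simp only [mul_one] at htr
    refine ⟨fun j => ?_, htr⟩
    have h1 := htr j
    rw [curveDiff_apply, curveDiff_apply, ← mul_add, abs_mul, abs_of_pos (by positivity)] at h1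
    have h2 := curveDiff_const_abs_le hz.1 hz.2 ((j : ℕ) + 1)
    have h3 : (1 : ℝ) ≤ P ^ (m - 1 - (j : ℕ)) := one_le_pow₀ hP
    have h4 : (1 : ℝ) ≤ (P / n) ^ ((j : ℕ) + 1) := one_le_pow₀ hH
    set X := ∑ l, (z.1.1 l - c') ^ ((j : ℕ) + 1) - ∑ l, (z.1.2 l - c') ^ ((j : ℕ) + 1)
    set Y := ∑ i, (z.2.1 i - c') ^ ((j : ℕ) + 1) - ∑ i, (z.2.2 i - c') ^ ((j : ℕ) + 1)
    have h5 : |X + Y| ≤ 2 ^ m := (le_mul_of_one_le_left (abs_nonneg _) h3).trans h1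
    have h6 : |X| ≤ |X + Y| + |Y| := by
      have := abs_sub (X + Y) Y
      rwa [add_sub_cancel_right] at this
    have h7 : (2 : ℝ) ^ m ≤ 2 ^ m * (P / n) ^ ((j : ℕ) + 1) :=
      le_mul_of_one_le_right (by positivity) h4
    calc |X| ≤ |X + Y| + |Y| := h6
      _ ≤ 2 ^ m * (P / n) ^ ((j : ℕ) + 1) + 2 * q * (P / n) ^ ((j : ℕ) + 1) := by linarith
      _ = B * (P / n) ^ ((j : ℕ) + 1) := by rw [hB]; ring
  set M : ℝ := (8 * 2 ^ m) ^ m * curveMean m q (P / n) c' η with hM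
  have hM0 : 0 ≤ M := mul_nonneg (by positivity) (curveMean_nonneg _ _ _ _ _)
  -- With the well-spaced variables frozen, their contribution is just a shift for the `2q` short
  -- ones, and the bound at scale P/n is uniform in it.
  have hslice : ∀ z₁, κ₂ (Prod.mk z₁ ⁻¹' E) ≤ T.indicator (fun _ => ENNReal.ofReal M) z₁ := by
    intro z₁
    by_cases hz : z₁ ∈ T
    · rw [Set.indicator_of_mem hz]
      have h1 := measure_curveDiff_add_le m q c' (by positivity : 0 < P / n) hHP η
        (curveDiff m P c' z₁) (A := 2 ^ m) (one_le_pow₀ (by norm_num))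
      refine le_trans (measure_mono ?_) ((ENNReal.le_ofReal_iff_toReal_le (measure_ne_top _ _)
        hM0).mpr h1)
      intro w hw j
      rw [add_comm]
      exact hw.2 j
    · rw [Set.indicator_of_notMem hz]
      have : Prod.mk z₁ ⁻¹' E = ∅ := by
        ext w
        simp [hE, hz]
      simp [this]
  -- Half of the well-spaced variables range freely, at cost N^m; given them, the power sums of the
  -- other half are prescribed up to the tolerance.
  have hTle : κ₁ T ≤ ((C₀ * n ^ (∑ j : Fin m, (m - 1 - (j : ℕ))) * N ^ m : ℕ) : ENNReal) := by
    rw [hκ₁, Measure.prod_apply_symm hTm]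
    calc ∫⁻ y, Measure.pi ν ((fun x => (x, y)) ⁻¹' T) ∂(Measure.pi ν)
        ≤ ∫⁻ _y, ((C₀ * n ^ (∑ j : Fin m, (m - 1 - (j : ℕ))) : ℕ) : ENNReal) ∂(Measure.pi ν) :=
          lintegral_mono fun y => hC₀ P n g c' (fun j => ∑ l, (y l - c') ^ ((j : ℕ) + 1)) ν hP hn
            hPn hg hνf hν hsep
      _ = ((C₀ * n ^ (∑ j : Fin m, (m - 1 - (j : ℕ))) : ℕ) : ENNReal) *
            ∏ l, ν l Set.univ := by rw [lintegral_const, Measure.pi_univ]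
      _ ≤ ((C₀ * n ^ (∑ j : Fin m, (m - 1 - (j : ℕ))) : ℕ) : ENNReal) *
            ∏ _l : Fin m, (N : ENNReal) := by
          gcongr with l
          exact hνN l
      _ = _ := by simp
  have hEle : (κ₁.prod κ₂) E ≤ ENNReal.ofReal M *
      ((C₀ * n ^ (∑ j : Fin m, (m - 1 - (j : ℕ))) * N ^ m : ℕ) : ENNReal) := by
    rw [Measure.prod_apply hEm]
    calc _ ≤ ∫⁻ z₁, T.indicator (fun _ => ENNReal.ofReal M) z₁ ∂κ₁ := lintegral_mono hslice
      _ = ENNReal.ofReal M * κ₁ T := by rw [lintegral_indicator_const hTm]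
      _ ≤ _ := by gcongr
  have hreal : (κ₁.prod κ₂).real {z | ∀ j, |σ z j| ≤ 1} ≤
      M * ((C₀ * n ^ (∑ j : Fin m, (m - 1 - (j : ℕ))) * N ^ m : ℕ) : ℝ) := by
    have h1 := hsub.trans hEle
    have h2 := ENNReal.toReal_mono (by finiteness) h1
    rwa [ENNReal.toReal_mul, ENNReal.toReal_ofReal hM0, ENNReal.toReal_natCast] at h2
  refine hup.trans ?_
  calc _ ≤ 8 ^ m * (M * ((C₀ * n ^ (∑ j : Fin m, (m - 1 - (j : ℕ))) * N ^ m : ℕ) : ℝ)) := by gcongr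
    _ ≤ 8 ^ m * (M * (((C₀ + 1) * n ^ (∑ j : Fin m, (m - 1 - (j : ℕ))) * N ^ m : ℕ) : ℝ)) := by
        gcongr
        omega
    _ = _ := by
        rw [hM]
        push_cast
        ring

/-! ### The broad-narrow dichotomy and subdivision into intervals -/

/-- Tuples of indices no two of which are equal or adjacent, in increasing order. -/
def Spaced {m : ℕ} (r : Fin m → ℕ) : Prop := ∀ i j, i < j → r i + 2 ≤ r j

lemma exists_spaced_of_card_le {m : ℕ} {A : Finset ℕ} (hA : 2 * m ≤ A.card) :
    ∃ r : Fin m → ℕ, Spaced r ∧ ∀ l, r l ∈ A := by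
  set e := A.orderEmbOfFin rfl with he
  -- Every second element of an increasing enumeration: the skipped element forces a gap of at least
  -- 2.
  refine ⟨fun l => e ⟨2 * l, by omega⟩, fun i j hij => ?_, fun l => A.orderEmbOfFin_mem rfl _⟩
  have h1 : e ⟨2 * i, by omega⟩ < e ⟨2 * i + 1, by omega⟩ := e.strictMono (by simp)
  have h2 : e ⟨2 * i + 1, by omega⟩ < e ⟨2 * j, by omega⟩ :=
    e.strictMono (by rw [Fin.mk_lt_mk]; have : (i : ℕ) < j := hij; omega)
  change e ⟨2 * i, _⟩ + 2 ≤ e ⟨2 * j, _⟩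
  omega

open Classical in
/-- The set of spaced tuples with entries less than `R`. -/
def spacedTuples (m R : ℕ) : Finset (Fin m → ℕ) :=
  (Fintype.piFinset fun _ => Finset.range R).filter Spaced

lemma mem_spacedTuples {m R : ℕ} {r : Fin m → ℕ} :
    r ∈ spacedTuples m R ↔ (∀ l, r l < R) ∧ Spaced r := by
  simp [spacedTuples]

/-- Either a sum is dominated by one of its terms, or there are many comparable well-spaced
terms. -/
lemma broad_narrow {m t R : ℕ} (hm : 1 ≤ m) (hR : 1 ≤ R) {F : ℝ} {a : ℕ → ℝ} (hF : 0 ≤ F)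
    (ha : ∀ r, 0 ≤ a r) (hFa : F ≤ ∑ r ∈ Finset.range R, a r) :
    F ^ (2 * (m * t)) ≤ (4 * m) ^ (2 * (m * t)) * ∑ r ∈ Finset.range R, a r ^ (2 * (m * t)) +
      (2 * R) ^ (2 * (m * t)) * ∑ r ∈ spacedTuples m R, ∏ l, a (r l) ^ (2 * t) := by
  have hR0 : (0 : ℝ) < R := by exact_mod_cast hR
  -- The terms below F/(2R) add up to at most F/2. If fewer than 2m terms are larger, they carry the
  -- remaining F/2 and the maximal one is at least F/(4m).
  set A := (Finset.range R).filter fun r => F ≤ 2 * R * a r with hA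
  by_cases hcard : 2 * m ≤ A.card
  · obtain ⟨r, hr, hrA⟩ := exists_spaced_of_card_le hcard
    have hmem : r ∈ spacedTuples m R := mem_spacedTuples.mpr
      ⟨fun l => Finset.mem_range.mp (Finset.mem_filter.mp (hrA l)).1, hr⟩
    have h1 : F ^ (2 * (m * t)) ≤ (2 * R) ^ (2 * (m * t)) * ∏ l, a (r l) ^ (2 * t) := by
      calc F ^ (2 * (m * t)) = ∏ _l : Fin m, F ^ (2 * t) := by
            rw [Finset.prod_const, Finset.card_univ, Fintype.card_fin, ← pow_mul]
            congr 1
            ring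
        _ ≤ ∏ l, (2 * R * a (r l)) ^ (2 * t) := by
            refine Finset.prod_le_prod (fun l _ => by positivity) fun l _ => ?_
            exact pow_le_pow_left₀ hF (Finset.mem_filter.mp (hrA l)).2 _
        _ = _ := by
            simp only [mul_pow _ (a _), Finset.prod_mul_distrib]
            rw [Finset.prod_const, Finset.card_univ, Fintype.card_fin, ← pow_mul]
            congr 2
            ring
    have h2 : ∏ l, a (r l) ^ (2 * t) ≤ ∑ r ∈ spacedTuples m R, ∏ l, a (r l) ^ (2 * t) :=
      Finset.single_le_sum (f := fun r => ∏ l, a (r l) ^ (2 * t))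
        (fun r _ => Finset.prod_nonneg fun l _ => pow_nonneg (ha _) _) hmem
    have h3 : 0 ≤ (4 * m : ℝ) ^ (2 * (m * t)) * ∑ r ∈ Finset.range R, a r ^ (2 * (m * t)) :=
      mul_nonneg (by positivity) (Finset.sum_nonneg fun r _ => pow_nonneg (ha r) _)
    have h4 := mul_le_mul_of_nonneg_left h2 (by positivity : (0 : ℝ) ≤ (2 * R) ^ (2 * (m * t)))
    linarith
  · push Not at hcard
    obtain ⟨r₀, hr₀, hmax⟩ := Finset.exists_max_image (Finset.range R) a
      ⟨0, Finset.mem_range.mpr (by omega)⟩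
    have hsplit := Finset.sum_filter_add_sum_filter_not (Finset.range R)
      (fun r => F ≤ 2 * R * a r) a
    have hin : ∑ r ∈ (Finset.range R).filter (fun r => F ≤ 2 * R * a r), a r ≤ 2 * m * a r₀ := by
      calc _ ≤ ∑ _r ∈ A, a r₀ :=
            Finset.sum_le_sum fun r hr => hmax r (Finset.mem_filter.mp hr).1
        _ = A.card * a r₀ := by simp
        _ ≤ 2 * m * a r₀ := by
            refine mul_le_mul_of_nonneg_right ?_ (ha _)
            exact_mod_cast hcard.le
    have hout : ∑ r ∈ (Finset.range R).filter (fun r => ¬ F ≤ 2 * R * a r), a r ≤ F / 2 := by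
      calc _ ≤ ∑ _r ∈ (Finset.range R).filter (fun r => ¬ F ≤ 2 * R * a r), F / (2 * R) := by
            refine Finset.sum_le_sum fun r hr => ?_
            have := (Finset.mem_filter.mp hr).2
            rw [le_div_iff₀ (by positivity)]
            linarith
        _ ≤ ∑ _r ∈ Finset.range R, F / (2 * R) :=
            Finset.sum_le_sum_of_subset_of_nonneg (Finset.filter_subset _ _)
              fun _ _ _ => by positivity
        _ = F / 2 := by simp; field_simp
    have hF4 : F ≤ 4 * m * a r₀ := by linarith
    have h1 : F ^ (2 * (m * t)) ≤ (4 * m) ^ (2 * (m * t)) * a r₀ ^ (2 * (m * t)) := by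
      rw [← mul_pow]
      exact pow_le_pow_left₀ hF hF4 _
    have h2 : a r₀ ^ (2 * (m * t)) ≤ ∑ r ∈ Finset.range R, a r ^ (2 * (m * t)) :=
      Finset.single_le_sum (f := fun r => a r ^ (2 * (m * t))) (fun r _ => pow_nonneg (ha r) _) hr₀
    have h3 : 0 ≤ (2 * R : ℝ) ^ (2 * (m * t)) *
        ∑ r ∈ spacedTuples m R, ∏ l, a (r l) ^ (2 * t) :=
      mul_nonneg (by positivity) (Finset.sum_nonneg fun r _ =>
        Finset.prod_nonneg fun l _ => pow_nonneg (ha _) _)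
    have h4 := mul_le_mul_of_nonneg_left h2 (by positivity : (0 : ℝ) ≤ (4 * m) ^ (2 * (m * t)))
    linarith

/-- Convexity of the `N`-th power; the constant is n^{N-1}, written as a quotient so that N = 0 is
covered. -/
lemma pow_sum_le_mul_sum_pow {n : ℕ} (hn : 1 ≤ n) {F : ℝ} {b : ℕ → ℝ} (hF : 0 ≤ F)
    (hb : ∀ s, 0 ≤ b s) (hFb : F ≤ ∑ s ∈ Finset.range n, b s) (N : ℕ) :
    F ^ N ≤ n ^ N / n * ∑ s ∈ Finset.range n, b s ^ N := by
  have hn0 : (0 : ℝ) < n := by exact_mod_cast hn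
  have h := Real.pow_arith_mean_le_arith_mean_pow (Finset.range n) (fun _ => (1 : ℝ) / n) b
    (fun _ _ => by positivity) (by simp; field_simp) (fun s _ => hb s) N
  rw [← Finset.mul_sum, ← Finset.mul_sum, mul_pow] at h
  calc F ^ N ≤ (∑ s ∈ Finset.range n, b s) ^ N := pow_le_pow_left₀ hF hFb _
    _ = n ^ N * ((1 / n) ^ N * (∑ s ∈ Finset.range n, b s) ^ N) := by
        rw [← mul_assoc, ← mul_pow]
        field_simp
        simp
    _ ≤ n ^ N * (1 / n * ∑ s ∈ Finset.range n, b s ^ N) := by gcongr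
    _ = _ := by ring

/-- One square of each factor is kept for the well-spaced variables; the rest of the product is at
most a power of the largest factor, and summing over `i` removes the dependence of that choice on
the frequency. -/
lemma prod_pow_succ_le {m t : ℕ} (hm : 1 ≤ m) {a : Fin m → ℝ} (ha : ∀ l, 0 ≤ a l) :
    ∏ l, a l ^ (2 * (t + 1)) ≤ ∑ i, (∏ l, a l ^ 2) * a i ^ (2 * (m * t)) := by
  obtain ⟨i₀, -, hmax⟩ := Finset.exists_max_image (Finset.univ : Finset (Fin m)) a
    ⟨⟨0, hm⟩, Finset.mem_univ _⟩
  have h0 : 0 ≤ ∏ l, a l ^ 2 := Finset.prod_nonneg fun l _ => by positivity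
  calc ∏ l, a l ^ (2 * (t + 1)) = (∏ l, a l ^ 2) * ∏ l, a l ^ (2 * t) := by
        rw [← Finset.prod_mul_distrib]
        refine Finset.prod_congr rfl fun l _ => ?_
        rw [← pow_add]
        congr 1
        ring
    _ ≤ (∏ l, a l ^ 2) * ∏ _l : Fin m, a i₀ ^ (2 * t) := by
        refine mul_le_mul_of_nonneg_left ?_ h0
        exact Finset.prod_le_prod (fun l _ => pow_nonneg (ha l) _) fun l _ =>
          pow_le_pow_left₀ (ha l) (hmax l (Finset.mem_univ l)) _
    _ = (∏ l, a l ^ 2) * a i₀ ^ (2 * (m * t)) := by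
        rw [Finset.prod_const, Finset.card_univ, Fintype.card_fin, ← pow_mul]
        congr 2
        ring
    _ ≤ _ := Finset.single_le_sum (f := fun i => (∏ l, a l ^ 2) * a i ^ (2 * (m * t)))
        (fun i _ => mul_nonneg h0 (pow_nonneg (ha i) _)) (Finset.mem_univ i₀)

/-- The `r`-th of the `R` consecutive subintervals of length `L / R` of `(a, a + L]`. -/
def piece (a L : ℝ) (R r : ℕ) : Set ℝ := Set.Ioc (a + L * r / R) (a + L * (r + 1) / R)

lemma measurableSet_piece (a L : ℝ) (R r : ℕ) : MeasurableSet (piece a L R r) := measurableSet_Ioc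

lemma cf_eq_sum_piece {m : ℕ} (ν : Measure ℝ) [IsFiniteMeasure ν] {σ : ℝ → Fin m → ℝ}
    (hσ : Measurable σ) {a L : ℝ} (hL : 0 ≤ L) (hν : ∀ᵐ x ∂ν, x ∈ Set.Ioc a (a + L)) {R : ℕ}
    (hR : 1 ≤ R) (β : Fin m → ℝ) :
    cf ν σ β = ∑ r ∈ Finset.range R, cf (ν.restrict (piece a L R r)) σ β := by
  have hR0 : (0 : ℝ) < R := by exact_mod_cast hR
  set b : ℕ → ℝ := fun r => a + L * r / R with hb
  have hint : ∀ r < R, IntervalIntegrable (fun x => ee (∑ j, β j * σ x j)) ν (b r) (b (r + 1)) :=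
    fun r _ => (integrable_ee_sum ν hσ β).intervalIntegrable
  have h1 := intervalIntegral.sum_integral_adjacent_intervals hint
  have hb0 : b 0 = a := by simp [hb]
  have hbR : b R = a + L := by simp only [hb]; field_simp
  have hpiece : ∀ r, piece a L R r = Set.Ioc (b r) (b (r + 1)) := by
    intro r; simp only [piece, hb]; push_cast; rfl
  rw [hb0, hbR, intervalIntegral.integral_of_le (by linarith),
    Measure.restrict_eq_self_of_ae_mem hν] at h1
  unfold cf
  rw [← h1]
  refine Finset.sum_congr rfl fun r _ => ?_
  rw [intervalIntegral.integral_of_le, hpiece]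
  simp only [hb]
  push_cast
  gcongr
  linarith

lemma norm_cf_le_sum_piece {m : ℕ} (ν : Measure ℝ) [IsFiniteMeasure ν] {σ : ℝ → Fin m → ℝ}
    (hσ : Measurable σ) {a L : ℝ} (hL : 0 ≤ L) (hν : ∀ᵐ x ∂ν, x ∈ Set.Ioc a (a + L)) {R : ℕ}
    (hR : 1 ≤ R) (β : Fin m → ℝ) :
    ‖cf ν σ β‖ ≤ ∑ r ∈ Finset.range R, ‖cf (ν.restrict (piece a L R r)) σ β‖ := by
  rw [cf_eq_sum_piece ν hσ hL hν hR β]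
  exact norm_sum_le _ _

/-- Take the floor of P^{1/m}; being at least 1, it loses at most a factor 2. -/
lemma exists_nat_root {m : ℕ} (hm : 1 ≤ m) {P : ℝ} (hP : 1 ≤ P) :
    ∃ n : ℕ, 1 ≤ n ∧ (n : ℝ) ≤ P ^ (1 / (m : ℝ)) ∧ (n : ℝ) ≤ P ∧ P ≤ (2 * n) ^ m := by
  have hm0 : (1 : ℝ) ≤ m := by exact_mod_cast hm
  have hroot : 1 ≤ P ^ (1 / (m : ℝ)) := Real.one_le_rpow hP (by positivity)
  have hle : P ^ (1 / (m : ℝ)) ≤ P := by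
    calc P ^ (1 / (m : ℝ)) ≤ P ^ (1 : ℝ) :=
          Real.rpow_le_rpow_of_exponent_le hP ((div_le_one (by linarith)).mpr hm0)
      _ = P := Real.rpow_one P
  have hfl : (⌊P ^ (1 / (m : ℝ))⌋₊ : ℝ) ≤ P ^ (1 / (m : ℝ)) := Nat.floor_le (by linarith)
  have hn1 : 1 ≤ ⌊P ^ (1 / (m : ℝ))⌋₊ := (Nat.one_le_floor_iff _).mpr hroot
  refine ⟨⌊P ^ (1 / (m : ℝ))⌋₊, hn1, hfl, hfl.trans hle, ?_⟩
  have hlt : P ^ (1 / (m : ℝ)) ≤ 2 * ⌊P ^ (1 / (m : ℝ))⌋₊ := by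
    have h1 := Nat.lt_floor_add_one (P ^ (1 / (m : ℝ)))
    have h2 : (1 : ℝ) ≤ ⌊P ^ (1 / (m : ℝ))⌋₊ := by exact_mod_cast hn1
    linarith
  calc P = (P ^ (1 / (m : ℝ))) ^ m := by
        rw [one_div, Real.rpow_inv_natCast_pow (by linarith) (by omega)]
    _ ≤ _ := pow_le_pow_left₀ (by positivity) hlt _

/-! ### The mean value bound: one step for well-spaced intervals -/

/-- A bound for the mean values of order `2q` of all measures with bounded unit masses. -/
def MeanBound (m q : ℕ) (D e : ℝ) : Prop :=
  ∀ (P c : ℝ) (ν : Measure ℝ), 1 ≤ P → IsFiniteMeasure ν → UnitBounded ν →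
    (∀ᵐ x ∂ν, x ∈ Set.Ioc (c - P) (c + P)) → curveMean m q P c ν ≤ D * P ^ e

lemma integrableOn_cube_of_continuous {m : ℕ} {f : (Fin m → ℝ) → ℝ} (hf : Continuous f) :
    IntegrableOn f (cube m) :=
  hf.continuousOn.integrableOn_compact isCompact_cube

lemma continuous_norm_cf_curve (m : ℕ) (P c : ℝ) (ν : Measure ℝ) [IsFiniteMeasure ν] :
    Continuous fun β => ‖cf ν (curve m P c) β‖ :=
  (continuous_cf ν (continuous_curve m P c).measurable).norm

lemma measure_univ_le {ν : Measure ℝ} (hν : UnitBounded ν) {P c : ℝ}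
    (hs : ∀ᵐ x ∂ν, x ∈ Set.Ioc (c - P) (c + P)) : ν Set.univ ≤ (⌈2 * P⌉₊ : ENNReal) := by
  refine le_trans (measure_mono_ae ?_) (hν.measure_Ioc_le (c - P) ⌈2 * P⌉₊)
  filter_upwards [hs] with x hx _
  exact ⟨hx.1, hx.2.trans (by linarith [Nat.le_ceil (2 * P)])⟩

lemma ceil_two_mul_le {P : ℝ} (hP : 1 ≤ P) : (⌈2 * P⌉₊ : ℝ) ≤ 3 * P := by
  have := Nat.ceil_lt_add_one (by linarith : 0 ≤ 2 * P)
  linarith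

/-- The separators are the midpoints of the pieces with index r_i + 1, which no spaced tuple uses
between r_i and r_{i+1}. They are half a piece, P/R, away from both neighbours, which is 1/R after
division by `P`. -/
lemma separatedBy_of_mem_piece {m R : ℕ} (hR : 1 ≤ R) {P c c' : ℝ} (hP : 0 < P) {r : Fin m → ℕ}
    (hr : Spaced r) {l : Fin m} {x : ℝ} (hx : x ∈ piece (c - P) (2 * P) R (r l)) :
    SeparatedBy (fun i => if h : i < m then
      ((c - P + P * (2 * r ⟨i, h⟩ + 3) / R) - c') / P else 0) (1 / R) l ((x - c') / P) := by
  have hR0 : (0 : ℝ) < R := by exact_mod_cast hR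
  have hdiv : ∀ y : ℝ, y / P + 1 / R = (y + P / R) / P := by intro y; field_simp
  have hdiv' : ∀ y : ℝ, y / P - 1 / R = (y - P / R) / P := by intro y; field_simp
  constructor
  · intro i hi
    have him : i < m := hi.trans l.isLt
    simp only [him, dif_pos]
    have h1 := hr ⟨i, him⟩ l hi
    have h2 : ((r ⟨i, him⟩ : ℝ)) + 2 ≤ r l := by exact_mod_cast h1
    rw [hdiv, div_le_div_iff_of_pos_right hP]
    have h3 : P * (2 * r ⟨i, him⟩ + 3) / R + P / R ≤ 2 * P * r l / R := by
      rw [← add_div, div_le_div_iff_of_pos_right hR0]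
      nlinarith
    have := hx.1
    linarith
  · intro i him hi
    have him' : i < m := by omega
    simp only [him', dif_pos]
    have h1 : r l ≤ r ⟨i, him'⟩ := by
      rcases hi.eq_or_lt with h | h
      · have : l = ⟨i, him'⟩ := Fin.ext h
        rw [this]
      · have := hr l ⟨i, him'⟩ h
        omega
    have h2 : (r l : ℝ) ≤ r ⟨i, him'⟩ := by exact_mod_cast h1
    rw [hdiv', div_le_div_iff_of_pos_right hP]
    have h3 : 2 * P * (r l + 1) / R ≤ P * (2 * r ⟨i, him'⟩ + 3) / R - P / R := by
      rw [← sub_div, div_le_div_iff_of_pos_right hR0]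
      nlinarith
    have := hx.2
    linarith

lemma abs_gap_le {m R : ℕ} (hR : 1 ≤ R) {P c c' : ℝ} (hP : 0 < P) (hc : |c - c'| ≤ P)
    {r : Fin m → ℕ} (hr : Spaced r) (hrR : ∀ l, r l < R) (i : ℕ) (hi : i + 1 < m) :
    |(if h : i < m then ((c - P + P * (2 * r ⟨i, h⟩ + 3) / R) - c') / P else 0)| ≤ 2 := by
  have hR0 : (0 : ℝ) < R := by exact_mod_cast hR
  have him : i < m := by omega
  simp only [him, dif_pos]
  have h1 := hr ⟨i, him⟩ ⟨i + 1, hi⟩ (by rw [Fin.mk_lt_mk]; omega)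
  have h2 := hrR ⟨i + 1, hi⟩
  have h3 : (r ⟨i, him⟩ : ℝ) + 3 ≤ R := by
    have : r ⟨i, him⟩ + 3 ≤ R := by omega
    exact_mod_cast this
  rw [abs_div, abs_of_pos hP, div_le_iff₀ hP, abs_le]
  rw [abs_le] at hc
  have h4 : 0 ≤ P * (2 * r ⟨i, him⟩ + 3) / R := by positivity
  have h5 : P * (2 * r ⟨i, him⟩ + 3) / R ≤ 2 * P := by
    rw [div_le_iff₀ hR0]
    nlinarith
  constructor <;> linarith [hc.1, hc.2]

lemma sum_fin_sub (m : ℕ) : ((∑ j : Fin m, (m - 1 - (j : ℕ)) : ℕ) : ℝ) = m * (m - 1) / 2 := by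
  rw [Fin.sum_univ_eq_sum_range (fun j => m - 1 - j), Finset.sum_range_reflect (fun j => j)]
  have := Finset.sum_range_id_mul_two m
  have h2 : ((∑ i ∈ Finset.range m, i : ℕ) : ℝ) * 2 = m * (m - 1 : ℕ) := by exact_mod_cast this
  rcases m with _ | m
  · simp
  · push_cast at h2 ⊢
    linarith

/-- The left side equals n^{m(m-1)/2 + Δ} P^{m + 2q - Δ}: the powers n^{2q} cancel. The exponent of
`n` is nonnegative, so n ≤ P^{1/m} may be inserted. -/
lemma broad_exponent {m : ℕ} (hm : 1 ≤ m) {q : ℕ} {P Δ : ℝ} {n : ℕ} (hP : 1 ≤ P) (hn : 1 ≤ n)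
    (hnP : (n : ℝ) ≤ P ^ (1 / (m : ℝ))) (hΔ : 0 ≤ Δ) :
    (n : ℝ) ^ (2 * q) * P ^ m * n ^ (∑ j : Fin m, (m - 1 - (j : ℕ))) *
        (P / n) ^ (2 * (q : ℝ) - Δ) ≤
      P ^ (2 * ((q + m : ℕ) : ℝ) - ((m + 1) / 2 + (1 - 1 / m) * Δ)) := by
  have hP0 : 0 < P := by linarith
  have hn0 : (0 : ℝ) < n := by exact_mod_cast hn
  have hm0 : (0 : ℝ) < m := by exact_mod_cast hm
  set e := ∑ j : Fin m, (m - 1 - (j : ℕ)) with he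
  have he' : (e : ℝ) = m * (m - 1) / 2 := sum_fin_sub m
  have h1 : (n : ℝ) ^ (2 * q) * P ^ m * n ^ e * (P / n) ^ (2 * (q : ℝ) - Δ) =
      (n : ℝ) ^ ((e : ℝ) + Δ) * P ^ ((m : ℝ) + (2 * q - Δ)) := by
    rw [Real.div_rpow hP0.le hn0.le, Real.rpow_add hP0, ← Real.rpow_natCast P m,
      ← Real.rpow_natCast _ (2 * q), ← Real.rpow_natCast _ e]
    have : (n : ℝ) ^ ((e : ℝ) + Δ) * (n : ℝ) ^ (2 * (q : ℝ) - Δ) =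
        (n : ℝ) ^ ((2 * q : ℕ) : ℝ) * (n : ℝ) ^ (e : ℝ) := by
      rw [← Real.rpow_add hn0, ← Real.rpow_add hn0]
      congr 1
      push_cast
      ring
    have hne : (n : ℝ) ^ (2 * (q : ℝ) - Δ) ≠ 0 := (Real.rpow_pos_of_pos hn0 _).ne'
    field_simp
    linear_combination -this
  rw [h1]
  calc (n : ℝ) ^ ((e : ℝ) + Δ) * P ^ ((m : ℝ) + (2 * q - Δ))
      ≤ (P ^ (1 / (m : ℝ))) ^ ((e : ℝ) + Δ) * P ^ ((m : ℝ) + (2 * q - Δ)) := by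
        gcongr
    _ = P ^ (1 / (m : ℝ) * ((e : ℝ) + Δ) + ((m : ℝ) + (2 * q - Δ))) := by
        rw [← Real.rpow_mul hP0.le, ← Real.rpow_add hP0]
    _ = _ := by
        congr 1
        rw [he']
        push_cast
        field_simp
        ring

/-- The contribution of well-spaced tuples of intervals. -/
lemma spaced_integral_le {m t R : ℕ} (hm : 1 ≤ m) (hR : 1 ≤ R) {D Δ : ℝ} (hD : 0 ≤ D)
    (hΔ : 0 ≤ Δ) (hmean : MeanBound m (m * t) D (2 * ((m * t : ℕ) : ℝ) - Δ)) :
    ∃ C : ℝ, 0 < C ∧ ∀ (P c : ℝ) (ν : Measure ℝ), 1 ≤ P → IsFiniteMeasure ν → UnitBounded ν →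
      (∀ᵐ x ∂ν, x ∈ Set.Ioc (c - P) (c + P)) → ∀ r ∈ spacedTuples m R,
      ∫ β in cube m, ∏ l, ‖cf (ν.restrict (piece (c - P) (2 * P) R (r l))) (curve m P c) β‖ ^
          (2 * (t + 1)) ≤
        C * P ^ (2 * ((m * (t + 1) : ℕ) : ℝ) - ((m + 1) / 2 + (1 - 1 / m) * Δ)) := by
  set q := m * t with hq
  have hR0 : (0 : ℝ) < R := by exact_mod_cast hR
  obtain ⟨C, hC0, hC⟩ := integral_prod_mul_le m q (κ := 1 / R) (G := 2) (by positivity)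
    (by rw [div_le_one hR0]; exact_mod_cast hR) (by norm_num)
  -- The factor `m` counts the possible largest factors, and 3^m comes from the total mass ⌈2P⌉ ≤
  -- 3P; the added 1 keeps the constant positive when `D` is 0.
  refine ⟨m * (C * 3 ^ m * D) + 1, by positivity, ?_⟩
  intro P c ν hP hνf hν hs r hr
  rw [mem_spacedTuples] at hr
  have hP0 : 0 < P := by linarith
  obtain ⟨n, hn1, hnroot, hnP, hPn⟩ := exists_nat_root hm hP
  have hn0 : (0 : ℝ) < n := by exact_mod_cast hn1
  set e := ∑ j : Fin m, (m - 1 - (j : ℕ)) with he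
  set ν' : Fin m → Measure ℝ := fun l => ν.restrict (piece (c - P) (2 * P) R (r l)) with hν'
  set f : Fin m → (Fin m → ℝ) → ℝ := fun l β => ‖cf (ν' l) (curve m P c) β‖ with hf
  set h : Fin m → ℕ → (Fin m → ℝ) → ℝ := fun l s β =>
    ‖cf ((ν' l).restrict (piece (c - P) (2 * P) n s)) (curve m P c) β‖ with hh
  have hfc : ∀ l, Continuous (f l) := fun l => continuous_norm_cf_curve m P c (ν' l)
  have hhc : ∀ l s, Continuous (h l s) := fun l s => continuous_norm_cf_curve m P c _
  have hs' : ∀ l, ∀ᵐ x ∂(ν' l), x ∈ Set.Ioc (c - P) (c - P + 2 * P) := by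
    intro l
    have h1 : ∀ᵐ x ∂(ν' l), x ∈ Set.Ioc (c - P) (c + P) := ae_restrict_of_ae hs
    filter_upwards [h1] with x hx
    rwa [show c - P + 2 * P = c + P by ring]
  -- the contribution of one short interval
  have hshort : ∀ i, ∀ s < n, ∫ β in cube m, (∏ l, f l β ^ 2) * h i s β ^ (2 * q) ≤
      C * (3 * P) ^ m * n ^ e * (D * (P / n) ^ (2 * (q : ℝ) - Δ)) := by
    intro i s hsn
    set c' := c - P + 2 * P * s / n + P / n with hc'
    have hsn' : (s : ℝ) + 1 ≤ n := by exact_mod_cast hsn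
    have hleft : c' - P / n = c - P + 2 * P * s / n := by rw [hc']; ring
    have hright : c' + P / n = c - P + 2 * P * (s + 1) / n := by rw [hc']; ring
    have hcc : |c - c'| ≤ P := by
      have h1 : 0 ≤ 2 * P * s / n := by positivity
      have h2 : 2 * P * (s + 1) / n ≤ 2 * P := by
        rw [div_le_iff₀ hn0]; nlinarith
      have h3 : 0 ≤ P / n := by positivity
      rw [abs_le]
      constructor <;> linarith
    have hηs : ∀ᵐ x ∂((ν' i).restrict (piece (c - P) (2 * P) n s)),
        x ∈ Set.Ioc (c' - P / n) (c' + P / n) := by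
      rw [hleft, hright]
      exact ae_restrict_mem (measurableSet_piece _ _ _ _)
    have h1 := hC P n ⌈2 * P⌉₊ (fun i => if h : i < m then
      ((c - P + P * (2 * r ⟨i, h⟩ + 3) / R) - c') / P else 0) c c' ν'
      ((ν' i).restrict (piece (c - P) (2 * P) n s)) hP hn1 hnP hPn
      (abs_gap_le hR hP0 hcc hr.2 hr.1) hcc (fun l => by rw [hν']; infer_instance) inferInstance
      (fun l => hν.restrict _)
      (fun l => measure_univ_le (hν.restrict _) (ae_restrict_of_ae hs))
      (fun l => by
        filter_upwards [ae_restrict_mem (measurableSet_piece (c - P) (2 * P) R (r l))] with x hx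
        exact separatedBy_of_mem_piece hR hP0 hr.2 hx)
      (by
        filter_upwards [hηs] with x hx
        rw [abs_le]
        constructor <;> linarith [hx.1, hx.2])
    have h2 := hmean (P / n) c' ((ν' i).restrict (piece (c - P) (2 * P) n s))
      (by rwa [one_le_div hn0]) inferInstance ((hν.restrict _).restrict _) hηs
    refine h1.trans ?_
    have h3 := ceil_two_mul_le hP
    have h4 := curveMean_nonneg m q (P / n) c' ((ν' i).restrict (piece (c - P) (2 * P) n s))
    gcongr
  have hpoint : ∀ β, ∏ l, f l β ^ (2 * (t + 1)) ≤ ∑ i, ∑ s ∈ Finset.range n,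
      (n : ℝ) ^ (2 * q) / n * ((∏ l, f l β ^ 2) * h i s β ^ (2 * q)) := by
    intro β
    refine (prod_pow_succ_le hm fun l => norm_nonneg _).trans ?_
    refine Finset.sum_le_sum fun i _ => ?_
    have h1 := pow_sum_le_mul_sum_pow hn1 (F := f i β) (b := fun s => h i s β) (norm_nonneg _)
      (fun s => norm_nonneg _) (norm_cf_le_sum_piece (ν' i) (continuous_curve m P c).measurable
        (by positivity) (hs' i) hn1 β) (2 * q)
    have h2 : 0 ≤ ∏ l, f l β ^ 2 := Finset.prod_nonneg fun l _ => by positivity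
    calc (∏ l, f l β ^ 2) * f i β ^ (2 * (m * t)) ≤
        (∏ l, f l β ^ 2) * ((n : ℝ) ^ (2 * q) / n * ∑ s ∈ Finset.range n, h i s β ^ (2 * q)) :=
          mul_le_mul_of_nonneg_left h1 h2
      _ = _ := by
          rw [← Finset.mul_sum, ← Finset.mul_sum]
          ring
  have hterm : ∀ i s, IntegrableOn (fun β => (n : ℝ) ^ (2 * q) / n *
      ((∏ l, f l β ^ 2) * h i s β ^ (2 * q))) (cube m) := by
    intro i s
    refine integrableOn_cube_of_continuous ?_
    have := hhc i s
    fun_prop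
  calc ∫ β in cube m, ∏ l, f l β ^ (2 * (t + 1))
      ≤ ∫ β in cube m, ∑ i, ∑ s ∈ Finset.range n,
          (n : ℝ) ^ (2 * q) / n * ((∏ l, f l β ^ 2) * h i s β ^ (2 * q)) := by
        refine setIntegral_mono (integrableOn_cube_of_continuous (by fun_prop)) ?_ hpoint
        exact integrable_finsetSum _ fun i _ => integrable_finsetSum _ fun s _ => hterm i s
    _ = ∑ i : Fin m, ∑ s ∈ Finset.range n, (n : ℝ) ^ (2 * q) / n *
          ∫ β in cube m, (∏ l, f l β ^ 2) * h i s β ^ (2 * q) := by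
        rw [integral_finsetSum _ fun i _ => integrable_finsetSum _ fun s _ => hterm i s]
        refine Finset.sum_congr rfl fun i _ => ?_
        rw [integral_finsetSum _ fun s _ => hterm i s]
        exact Finset.sum_congr rfl fun s _ => integral_const_mul _ _
    _ ≤ ∑ _i : Fin m, ∑ _s ∈ Finset.range n, (n : ℝ) ^ (2 * q) / n *
          (C * (3 * P) ^ m * n ^ e * (D * (P / n) ^ (2 * (q : ℝ) - Δ))) := by
        refine Finset.sum_le_sum fun i _ => Finset.sum_le_sum fun s hsn => ?_
        exact mul_le_mul_of_nonneg_left (hshort i s (Finset.mem_range.mp hsn)) (by positivity)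
    _ = m * (C * 3 ^ m * D) * ((n : ℝ) ^ (2 * q) * P ^ m * n ^ e *
          (P / n) ^ (2 * (q : ℝ) - Δ)) := by
        simp only [Finset.sum_const, Finset.card_univ, Fintype.card_fin, Finset.card_range,
          nsmul_eq_mul]
        rw [mul_pow]
        field_simp
    _ ≤ m * (C * 3 ^ m * D) *
          P ^ (2 * ((q + m : ℕ) : ℝ) - ((m + 1) / 2 + (1 - 1 / m) * Δ)) :=
        mul_le_mul_of_nonneg_left (broad_exponent hm hP hn1 hnroot hΔ) (by positivity)
    _ ≤ (m * (C * 3 ^ m * D) + 1) *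
          P ^ (2 * ((q + m : ℕ) : ℝ) - ((m + 1) / 2 + (1 - 1 / m) * Δ)) := by
        gcongr
        linarith
    _ = _ := by rw [hq, Nat.mul_succ]

/-! ### The exponent Δ(τ) and the induction on τ -/

lemma Delta_zero (m : ℕ) : Delta m 0 = 0 := by simp [Delta]

lemma Delta_succ {m : ℕ} (hm : 1 ≤ m) (τ : ℕ) :
    Delta m (τ + 1) = ((m : ℝ) + 1) / 2 + (1 - 1 / m) * Delta m τ := by
  have hm0 : (m : ℝ) ≠ 0 := by positivity
  unfold Delta
  rw [pow_succ]
  generalize (1 - 1 / (m : ℝ)) ^ τ = x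
  field_simp
  ring

lemma Delta_nonneg {m : ℕ} (hm : 1 ≤ m) (τ : ℕ) : 0 ≤ Delta m τ := by
  have hm1 : (1 : ℝ) ≤ m := by exact_mod_cast hm
  have h0 : 0 ≤ 1 - 1 / (m : ℝ) := sub_nonneg.mpr ((div_le_one (by linarith)).mpr hm1)
  have h1 : (1 - 1 / (m : ℝ)) ^ τ ≤ 1 :=
    pow_le_one₀ h0 (sub_le_self _ (by positivity))
  unfold Delta
  have : 0 ≤ 1 - (1 - 1 / (m : ℝ)) ^ τ := by linarith
  positivity

lemma Delta_le {m : ℕ} (hm : 1 ≤ m) (τ : ℕ) : Delta m τ ≤ 2 * ((m * τ : ℕ) : ℝ) := by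
  have hm1 : (1 : ℝ) ≤ m := by exact_mod_cast hm
  induction τ with
  | zero => simp [Delta_zero]
  | succ τ ih =>
    rw [Delta_succ hm]
    have h0 := Delta_nonneg hm τ
    have h1 : (1 - 1 / (m : ℝ)) * Delta m τ ≤ Delta m τ :=
      mul_le_of_le_one_left h0 (sub_le_self _ (by positivity))
    push_cast at ih ⊢
    linarith

/-- The inner induction on the scale must beat the number `R` of pieces with a further power of `R`
to spare. By the recursion and `Delta_le`, the exponent is at least 2m - (m + 1)/2. -/
lemma two_le_exponent {m : ℕ} (hm : 2 < m) (τ : ℕ) :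
    2 ≤ 2 * ((m * (τ + 1) : ℕ) : ℝ) - Delta m (τ + 1) := by
  have hm1 : (3 : ℝ) ≤ m := by exact_mod_cast hm
  rw [Delta_succ (by omega)]
  have h0 := Delta_nonneg (by omega : 1 ≤ m) τ
  have h1 : (1 - 1 / (m : ℝ)) * Delta m τ ≤ Delta m τ :=
    mul_le_of_le_one_left h0 (sub_le_self _ (by positivity))
  have h2 := Delta_le (by omega : 1 ≤ m) τ
  push_cast at h2 ⊢
  linarith

lemma curveMean_le_trivial (m k : ℕ) {P c : ℝ} {ν : Measure ℝ} (hP : 1 ≤ P) [IsFiniteMeasure ν]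
    (hν : UnitBounded ν) (hs : ∀ᵐ x ∂ν, x ∈ Set.Ioc (c - P) (c + P)) :
    curveMean m k P c ν ≤ 2 ^ m * (3 * P) ^ (2 * k) := by
  have hmass : ν.real Set.univ ≤ 3 * P := by
    have h1 := ENNReal.toReal_mono (by finiteness) (measure_univ_le hν hs)
    exact h1.trans (by simpa using ceil_two_mul_le hP)
  calc curveMean m k P c ν ≤ ∫ _β in cube m, (3 * P) ^ (2 * k) := by
        refine setIntegral_mono
          (integrableOn_cube_of_continuous ((continuous_norm_cf_curve m P c ν).pow _))
          (integrableOn_cube_of_continuous continuous_const) fun β => ?_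
        exact pow_le_pow_left₀ (norm_nonneg _) ((norm_cf_le ν _ β).trans hmass) _
    _ = 2 ^ m * (3 * P) ^ (2 * k) := by
        rw [setIntegral_const, volume_real_cube, smul_eq_mul]

lemma curveMean_le_sum {m t R : ℕ} (hm : 1 ≤ m) (hR : 1 ≤ R) {P c : ℝ} (hP : 0 < P)
    (ν : Measure ℝ) [IsFiniteMeasure ν] (hs : ∀ᵐ x ∂ν, x ∈ Set.Ioc (c - P) (c + P)) :
    curveMean m (m * t) P c ν ≤ (4 * m) ^ (2 * (m * t)) * ∑ r ∈ Finset.range R,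
        curveMean m (m * t) P c (ν.restrict (piece (c - P) (2 * P) R r)) +
      (2 * R) ^ (2 * (m * t)) * ∑ r ∈ spacedTuples m R, ∫ β in cube m,
        ∏ l, ‖cf (ν.restrict (piece (c - P) (2 * P) R (r l))) (curve m P c) β‖ ^ (2 * t) := by
  set k := m * t with hk
  set f : ℕ → (Fin m → ℝ) → ℝ := fun r β =>
    ‖cf (ν.restrict (piece (c - P) (2 * P) R r)) (curve m P c) β‖ with hf
  have hfc : ∀ r, Continuous (f r) := fun r => continuous_norm_cf_curve m P c _
  have h1 : ∀ r, IntegrableOn (fun β => f r β ^ (2 * k)) (cube m) := fun r =>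
    integrableOn_cube_of_continuous ((hfc r).pow _)
  have h2 : ∀ r : Fin m → ℕ, IntegrableOn (fun β => ∏ l, f (r l) β ^ (2 * t)) (cube m) :=
    fun r => integrableOn_cube_of_continuous (by fun_prop)
  have hpoint : ∀ β, ‖cf ν (curve m P c) β‖ ^ (2 * k) ≤
      (4 * m) ^ (2 * k) * ∑ r ∈ Finset.range R, f r β ^ (2 * k) +
      (2 * R) ^ (2 * k) * ∑ r ∈ spacedTuples m R, ∏ l, f (r l) β ^ (2 * t) := by
    intro β
    refine broad_narrow hm hR (norm_nonneg _) (fun r => norm_nonneg _) ?_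
    refine norm_cf_le_sum_piece ν (continuous_curve m P c).measurable (by positivity) ?_ hR β
    filter_upwards [hs] with x hx
    rwa [show c - P + 2 * P = c + P by ring]
  have hi1 : IntegrableOn (fun β => (4 * m : ℝ) ^ (2 * k) *
      ∑ r ∈ Finset.range R, f r β ^ (2 * k)) (cube m) :=
    (integrable_finsetSum _ fun r _ => h1 r).const_mul _
  have hi2 : IntegrableOn (fun β => (2 * R : ℝ) ^ (2 * k) *
      ∑ r ∈ spacedTuples m R, ∏ l, f (r l) β ^ (2 * t)) (cube m) :=
    (integrable_finsetSum _ fun r _ => h2 r).const_mul _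
  calc curveMean m k P c ν ≤ ∫ β in cube m, ((4 * m) ^ (2 * k) *
        ∑ r ∈ Finset.range R, f r β ^ (2 * k) +
      (2 * R) ^ (2 * k) * ∑ r ∈ spacedTuples m R, ∏ l, f (r l) β ^ (2 * t)) :=
        setIntegral_mono
          (integrableOn_cube_of_continuous ((continuous_norm_cf_curve m P c ν).pow _))
          (hi1.add hi2) hpoint
    _ = _ := by
        rw [integral_add hi1 hi2, integral_const_mul, integral_const_mul,
          integral_finsetSum _ fun r _ => h1 r, integral_finsetSum _ fun r _ => h2 r]
        rfl

/-- The inductive step: passing from moments of order `2mt` to moments of order `2m(t + 1)`. -/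
lemma MeanBound.succ {m t : ℕ} (hm : 1 ≤ m) {D Δ E : ℝ} (hD : 0 ≤ D)
    (hΔ : 0 ≤ Δ) (hmean : MeanBound m (m * t) D (2 * ((m * t : ℕ) : ℝ) - Δ))
    (hE : E = 2 * ((m * (t + 1) : ℕ) : ℝ) - ((m + 1) / 2 + (1 - 1 / m) * Δ)) (hE2 : 2 ≤ E) :
    ∃ D' : ℝ, 0 < D' ∧ MeanBound m (m * (t + 1)) D' E := by
  set k := m * (t + 1) with hk
  set CA : ℝ := 8 ^ m * (8 * 2 ^ m) ^ m with hCA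
  -- The `R` narrow pieces at scale P/R cost (4m)^{2k} · CA · R · R^{-E} relative to the claimed
  -- bound. Since E ≥ 2 this is at most (4m)^{2k} CA / R, and `R` is chosen to make it at most 1/2.
  obtain ⟨R, hRle⟩ := exists_nat_ge (2 * (4 * m) ^ (2 * k) * CA + 2)
  have hCA0 : 0 < CA := by positivity
  have hR2 : (2 : ℝ) ≤ R := le_trans (le_add_of_nonneg_left (by positivity)) hRle
  have hR0 : (0 : ℝ) < R := by linarith
  have hR1 : 1 ≤ R := by exact_mod_cast (by linarith : (1 : ℝ) ≤ R)
  have hRle' : 2 * (4 * m) ^ (2 * k) * CA ≤ R := by linarith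
  obtain ⟨C, hC0, hC⟩ := spaced_integral_le hm hR1 hD hΔ hmean
  set D₁ : ℝ := 2 ^ m * (3 * R) ^ (2 * k) with hD₁
  set D₂ : ℝ := 2 * ((2 * R) ^ (2 * k) * ((spacedTuples m R).card * C)) with hD₂
  have hD₁0 : 0 < D₁ := by positivity
  have hD₂0 : 0 ≤ D₂ := by positivity
  -- `D₁` covers the range P ≤ R by the trivial bound. `D₂` is twice the broad contribution, so that
  -- the narrow and the broad halves add up to no more than the total.
  refine ⟨D₁ + D₂, by positivity, ?_⟩
  have htriv : ∀ (P c : ℝ) (ν : Measure ℝ), 1 ≤ P → P ≤ R → IsFiniteMeasure ν → UnitBounded ν →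
    (∀ᵐ x ∂ν, x ∈ Set.Ioc (c - P) (c + P)) → curveMean m k P c ν ≤ (D₁ + D₂) * P ^ E := by
    intro P c ν hP hPR _ hν hs
    calc curveMean m k P c ν ≤ 2 ^ m * (3 * P) ^ (2 * k) := curveMean_le_trivial m k hP hν hs
      _ ≤ D₁ := by rw [hD₁]; gcongr
      _ ≤ D₁ + D₂ := by linarith
      _ ≤ (D₁ + D₂) * P ^ E :=
          le_mul_of_one_le_right (by positivity) (Real.one_le_rpow hP (by linarith))
  -- Induction on the scale, uniform in centre and measure: each narrow piece is again a measure
  -- with bounded unit masses, at scale P/R and with a new centre.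
  have hind : ∀ (N : ℕ) (P c : ℝ) (ν : Measure ℝ), 1 ≤ P → P ≤ R ^ N → IsFiniteMeasure ν →
      UnitBounded ν → (∀ᵐ x ∂ν, x ∈ Set.Ioc (c - P) (c + P)) →
      curveMean m k P c ν ≤ (D₁ + D₂) * P ^ E := by
    intro N
    induction N with
    | zero =>
      intro P c ν hP hPR hf hν hs
      exact htriv P c ν hP (by rw [pow_zero] at hPR; linarith) hf hν hs
    | succ N ih =>
      intro P c ν hP hPR hf hν hs
      rcases le_total P R with hle | hge
      · exact htriv P c ν hP hle hf hν hs
      have hP0 : 0 < P := by linarith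
      have hPR1 : 1 ≤ P / R := by rwa [one_le_div hR0]
      have hPR2 : P / R ≤ R ^ N := by
        rw [div_le_iff₀ hR0, ← pow_succ]; exact hPR
      have hnarrow : ∀ r ∈ Finset.range R,
          curveMean m k P c (ν.restrict (piece (c - P) (2 * P) R r)) ≤
            CA * ((D₁ + D₂) * (P / R) ^ E) := by
        intro r hr
        have hrR : (r : ℝ) + 1 ≤ R := by exact_mod_cast Finset.mem_range.mp hr
        set c' := c - P + 2 * P * r / R + P / R with hc'
        have hleft : c' - P / R = c - P + 2 * P * r / R := by rw [hc']; ring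
        have hright : c' + P / R = c - P + 2 * P * (r + 1) / R := by rw [hc']; ring
        have hcc : |c - c'| ≤ P := by
          have h1 : 0 ≤ 2 * P * r / R := by positivity
          have h2 : 2 * P * (r + 1) / R ≤ 2 * P := by
            rw [div_le_iff₀ hR0]; nlinarith
          rw [abs_le]
          constructor <;> linarith
        refine (curveMean_le_curveMean m k (by linarith : 0 < P / R)
          (div_le_self hP0.le (by linarith)) hcc _).trans ?_
        refine mul_le_mul_of_nonneg_left (ih (P / R) c' _ hPR1 hPR2 inferInstance
          (hν.restrict _) ?_) hCA0.le
        rw [hleft, hright]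
        exact ae_restrict_mem (measurableSet_piece _ _ _ _)
      have hbroad : ∀ r ∈ spacedTuples m R, ∫ β in cube m,
          ∏ l, ‖cf (ν.restrict (piece (c - P) (2 * P) R (r l))) (curve m P c) β‖ ^ (2 * (t + 1)) ≤
          C * P ^ E := by
        intro r hr
        rw [hE]
        exact hC P c ν hP hf hν hs r hr
      have hPE : 0 < P ^ E := Real.rpow_pos_of_pos hP0 _
      have hdecay : (P / R) ^ E * (R * R) ≤ P ^ E := by
        rw [Real.div_rpow hP0.le hR0.le, div_mul_eq_mul_div,
          div_le_iff₀ (Real.rpow_pos_of_pos hR0 _)]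
        have : (R : ℝ) * R ≤ (R : ℝ) ^ E := by
          calc (R : ℝ) * R = (R : ℝ) ^ (2 : ℝ) := by rw [Real.rpow_two]; ring
            _ ≤ (R : ℝ) ^ E := Real.rpow_le_rpow_of_exponent_le (by linarith) hE2
        gcongr
      have hx0 : 0 ≤ (P / R) ^ E := by positivity
      calc curveMean m k P c ν ≤ _ := curveMean_le_sum hm hR1 hP0 ν hs
        _ ≤ (4 * m) ^ (2 * k) * ∑ _r ∈ Finset.range R, CA * ((D₁ + D₂) * (P / R) ^ E) +
            (2 * R) ^ (2 * k) * ∑ _r ∈ spacedTuples m R, C * P ^ E := by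
            gcongr with r hr r hr
            · exact hnarrow r hr
            · exact hbroad r hr
        _ = ((4 * m) ^ (2 * k) * CA) * (D₁ + D₂) * ((P / R) ^ E * R) + D₂ / 2 * P ^ E := by
            simp only [Finset.sum_const, Finset.card_range, nsmul_eq_mul]
            rw [hD₂]
            ring
        _ ≤ (R / 2) * (D₁ + D₂) * ((P / R) ^ E * R) + D₂ / 2 * P ^ E := by
            gcongr
            linarith
        _ = (D₁ + D₂) / 2 * ((P / R) ^ E * (R * R)) + D₂ / 2 * P ^ E := by ring
        _ ≤ (D₁ + D₂) / 2 * P ^ E + D₂ / 2 * P ^ E := by gcongr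
        _ ≤ (D₁ + D₂) * P ^ E := by nlinarith
  intro P c ν hP hf hν hs
  obtain ⟨N, hN⟩ := pow_unbounded_of_one_lt P (by linarith : (1 : ℝ) < R)
  exact hind N P c ν hP hN.le hf hν hs

/-- The mean value theorem for measures with bounded unit masses. -/
theorem exists_meanBound {m : ℕ} (hm : 2 < m) (τ : ℕ) :
    ∃ D : ℝ, 0 < D ∧ MeanBound m (m * τ) D (2 * ((m * τ : ℕ) : ℝ) - Delta m τ) := by
  induction τ with
  | zero =>
    refine ⟨2 ^ m, by positivity, fun P c ν _ _ _ _ => ?_⟩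
    simp [curveMean, Delta_zero, volume_real_cube]
  | succ τ ih =>
    obtain ⟨D, hD, hmean⟩ := ih
    exact MeanBound.succ (by omega) hD.le (Delta_nonneg (by omega) τ) hmean
      (by rw [Delta_succ (by omega)]) (two_le_exponent hm τ)

/-! ### From random variables to measures with bounded unit masses -/

section RandomVariables

variable {Ω : Type*} [MeasurableSpace Ω]

lemma truncCharFun_eq_cf (μ : Measure Ω) {S : Ω → ℝ} (hS : Measurable S) (P : ℝ) {m : ℕ}
    (α : Fin m → ℝ) : truncCharFun μ S P α =
      cf ((μ.map S).restrict (Set.Ioc (-P) P)) (curve m 1 0) α := by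
  unfold truncCharFun cf
  rw [integral_indicator (hS measurableSet_Ioc), Measure.restrict_map hS measurableSet_Ioc,
    integral_map hS.aemeasurable
      (measurable_ee_sum (continuous_curve m 1 0).measurable α).aestronglyMeasurable]
  congr 1
  ext ω
  simp [ee, poly, curve]

lemma cf_curve_rescale (ν : Measure ℝ) {m : ℕ} (P : ℝ) (β : Fin m → ℝ) :
    cf ν (curve m 1 0) (fun j => P ^ (m - 1 - (j : ℕ)) * β j) = cf ν (curve m P 0) β := by
  unfold cf
  congr 1
  ext x
  congr 1
  refine Finset.sum_congr rfl fun j _ => ?_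
  simp only [curve, one_pow, one_mul]
  ring

/-- The diagonal map with entries P^{m-1-j} carries the cube onto the box; its determinant is
P^{m(m-1)/2}, which the normalization in `meanValue` cancels. -/
lemma setIntegral_coeffBox {m : ℕ} {P : ℝ} (hP : 0 < P) {G : (Fin m → ℝ) → ℝ}
    (hG : Continuous G) : ∫ α in coeffBox m P, G α =
      P ^ (∑ j : Fin m, (m - 1 - (j : ℕ))) *
        ∫ β in cube m, G (fun j => P ^ (m - 1 - (j : ℕ)) * β j) := by
  set d : Fin m → ℝ := fun j => P ^ (m - 1 - (j : ℕ)) with hd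
  have hdpos : ∀ j, 0 < d j := fun j => by positivity
  have hdet : (Matrix.diagonal d).det = P ^ (∑ j : Fin m, (m - 1 - (j : ℕ))) := by
    rw [Matrix.det_diagonal, Finset.prod_pow_eq_pow_sum]
  have hdet0 : (Matrix.diagonal d).det ≠ 0 := by rw [hdet]; positivity
  have hvol := Real.smul_map_diagonal_volume_pi hdet0
  have hbox : MeasurableSet (coeffBox m P) := by
    unfold coeffBox
    rw [Set.ofPred_forall]
    exact MeasurableSet.iInter fun j => (measurable_pi_apply j) measurableSet_Icc
  have hL : ∀ β : Fin m → ℝ, Matrix.toLin' (Matrix.diagonal d) β = fun j => d j * β j := by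
    intro β
    ext j
    rw [Matrix.toLin'_apply, Matrix.mulVec_diagonal]
  have hLm : Measurable (Matrix.toLin' (Matrix.diagonal d)) := by
    have : (Matrix.toLin' (Matrix.diagonal d) : (Fin m → ℝ) → Fin m → ℝ) =
      fun β j => d j * β j := funext hL
    rw [this]
    fun_prop
  have hmem : ∀ β : Fin m → ℝ, (fun j => d j * β j) ∈ coeffBox m P ↔ β ∈ cube m := by
    intro β
    rw [mem_cube]
    refine forall_congr' fun j => ?_
    have : P ^ (m - ((j : ℕ) + 1)) = d j := by simp only [hd]; congr 1; omega
    rw [this, Set.mem_Icc, ← abs_le, abs_mul, abs_of_pos (hdpos j)]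
    exact mul_le_iff_le_one_right (hdpos j)
  rw [← integral_indicator hbox]
  conv_lhs => rw [← hvol]
  rw [integral_smul_measure, ← integral_indicator
    measurableSet_cube, integral_map hLm.aemeasurable, ENNReal.toReal_ofReal (abs_nonneg _), hdet,
    abs_of_pos (by positivity), smul_eq_mul]
  · congr 2
    ext β
    rw [hL]
    by_cases hb : β ∈ cube m
    · rw [Set.indicator_of_mem hb, Set.indicator_of_mem ((hmem β).mpr hb)]
    · rw [Set.indicator_of_notMem hb, Set.indicator_of_notMem (fun h => hb ((hmem β).mp h))]
  · exact (hG.measurable.indicator hbox).aestronglyMeasurable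

lemma meanValue_eq_curveMean (μ : Measure Ω) [IsProbabilityMeasure μ] {S : Ω → ℝ}
    (hS : Measurable S) (m k : ℕ) {P : ℝ} (hP : 0 < P) :
    meanValue μ S m k P = curveMean m k P 0 ((μ.map S).restrict (Set.Ioc (-P) P)) := by
  have : IsProbabilityMeasure (μ.map S) := Measure.isProbabilityMeasure_map hS.aemeasurable
  unfold meanValue
  simp_rw [truncCharFun_eq_cf μ hS]
  rw [setIntegral_coeffBox hP (G := fun α => ‖cf _ (curve m 1 0) α‖ ^ (2 * k))
    ((continuous_norm_cf_curve m 1 0 _).pow _), ← mul_assoc]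
  simp_rw [cf_curve_rescale]
  rw [← Real.rpow_natCast P (∑ j : Fin m, (m - 1 - (j : ℕ))), ← Real.rpow_add hP, sum_fin_sub]
  have : -(((m : ℝ) - 1) * m / 2) + m * (m - 1) / 2 = 0 := by ring
  rw [this, Real.rpow_zero, one_mul]
  rfl

lemma cf_smul_measure {m : ℕ} (c : ENNReal) (ν : Measure ℝ) (σ : ℝ → Fin m → ℝ)
    (β : Fin m → ℝ) : cf (c • ν) σ β = c.toReal * cf ν σ β := by
  unfold cf
  rw [integral_smul_measure, Complex.real_smul]

lemma curveMean_smul_measure (m k : ℕ) (P : ℝ) (c : ENNReal) (ν : Measure ℝ) :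
    curveMean m k P 0 (c • ν) = c.toReal ^ (2 * k) * curveMean m k P 0 ν := by
  unfold curveMean
  rw [← integral_const_mul]
  congr 1
  ext β
  rw [cf_smul_measure, norm_mul, Complex.norm_real, Real.norm_of_nonneg ENNReal.toReal_nonneg,
    mul_pow]

lemma le_concentration (μ : Measure Ω) [IsProbabilityMeasure μ] (S : Ω → ℝ) (a : ℝ) :
    μ.real (S ⁻¹' Set.Ioc a (a + 1)) ≤ concentration μ S :=
  le_ciSup (f := fun a : ℝ => μ.real (S ⁻¹' Set.Ioc a (a + 1)))
    ⟨1, by rintro _ ⟨a, rfl⟩; exact measureReal_le_one⟩ a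

/-- Countably many unit intervals cover the line, so they cannot all be null. Positivity is needed
to divide by the concentration. -/
lemma concentration_pos (μ : Measure Ω) [IsProbabilityMeasure μ] (S : Ω → ℝ) :
    0 < concentration μ S := by
  by_contra h
  push Not at h
  have h0 : ∀ a : ℝ, μ (S ⁻¹' Set.Ioc a (a + 1)) = 0 := by
    intro a
    have h1 := (le_concentration μ S a).trans h
    have h2 : μ.real (S ⁻¹' Set.Ioc a (a + 1)) = 0 := le_antisymm h1 measureReal_nonneg
    rwa [measureReal_eq_zero_iff] at h2
  have h3 : (Set.univ : Set Ω) ⊆ ⋃ n : ℤ, S ⁻¹' Set.Ioc (n : ℝ) (n + 1) := by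
    intro ω _
    rw [Set.mem_iUnion]
    refine ⟨⌈S ω⌉ - 1, ?_, ?_⟩
    · push_cast
      linarith [Int.ceil_lt_add_one (S ω)]
    · push_cast
      linarith [Int.le_ceil (S ω)]
  have h4 : μ Set.univ = 0 :=
    measure_mono_null h3 (measure_iUnion_null fun n => h0 n)
  simp at h4

/-- Dividing the truncated law by its concentration makes its unit masses at most 1; `curveMean` is
homogeneous of degree 2k in the measure, which restores the factor. -/
lemma MeanBound.meanValue_le {m k : ℕ} {D E : ℝ} (h : MeanBound m k D E)
    (μ : Measure Ω) [IsProbabilityMeasure μ] {S : Ω → ℝ} (hS : Measurable S) {P : ℝ}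
    (hP : 1 ≤ P) : meanValue μ S m k P ≤ D * P ^ E * concentration μ S ^ (2 * k) := by
  have : IsProbabilityMeasure (μ.map S) := Measure.isProbabilityMeasure_map hS.aemeasurable
  rw [meanValue_eq_curveMean μ hS m k (by linarith)]
  set Q := concentration μ S with hQ
  have hQ0 : 0 < Q := concentration_pos μ S
  set ν := (μ.map S).restrict (Set.Ioc (-P) P) with hν
  have hfin : IsFiniteMeasure (ENNReal.ofReal Q⁻¹ • ν) :=
    Measure.smul_finite ν ENNReal.ofReal_ne_top
  have hunit : UnitBounded (ENNReal.ofReal Q⁻¹ • ν) := by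
    intro a
    rw [Measure.smul_apply, smul_eq_mul]
    calc ENNReal.ofReal Q⁻¹ * ν (Set.Ioc a (a + 1))
        ≤ ENNReal.ofReal Q⁻¹ * μ (S ⁻¹' Set.Ioc a (a + 1)) := by
          gcongr
          rw [← Measure.map_apply hS measurableSet_Ioc]
          exact Measure.restrict_apply_le _ _
      _ ≤ ENNReal.ofReal Q⁻¹ * ENNReal.ofReal Q := by
          gcongr
          rw [← ofReal_measureReal]
          exact ENNReal.ofReal_le_ofReal (le_concentration μ S a)
      _ = 1 := by
          rw [← ENNReal.ofReal_mul (by positivity), inv_mul_cancel₀ hQ0.ne', ENNReal.ofReal_one]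
  have hs : ∀ᵐ x ∂(ENNReal.ofReal Q⁻¹ • ν), x ∈ Set.Ioc (0 - P) (0 + P) := by
    rw [zero_sub, zero_add]
    exact Measure.ae_smul_measure (ae_restrict_mem measurableSet_Ioc) _
  have key := h P 0 _ hP hfin hunit hs
  rw [curveMean_smul_measure, ENNReal.toReal_ofReal (by positivity), inv_pow,
    inv_mul_le_iff₀ (by positivity)] at key
  linarith

end RandomVariables

/-! ### Orthogonality and the count of integer solutions -/

lemma integral_ee_Icc (N : ℤ) :
    ∫ x in Set.Icc (-1 : ℝ) 1, ee (x * N) = if N = 0 then 2 else 0 := by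
  rw [integral_Icc_eq_integral_Ioc, ← intervalIntegral.integral_of_le (by norm_num)]
  split_ifs with h
  · simp [h, ee_zero]
    norm_num
  · have hc : (2 * Real.pi * Complex.I * N : ℂ) ≠ 0 := by
      have : (N : ℂ) ≠ 0 := by exact_mod_cast h
      simp [Real.pi_ne_zero, this]
    have h1 : ∀ x : ℝ, ee (x * N) = Complex.exp ((2 * Real.pi * Complex.I * N) * x) := by
      intro x
      rw [ee]
      congr 1
      push_cast
      ring
    simp_rw [h1]
    rw [integral_exp_mul_complex hc]
    have e1 : Complex.exp (2 * Real.pi * Complex.I * N * ((1 : ℝ) : ℂ)) = 1 := by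
      rw [Complex.exp_eq_one_iff]
      exact ⟨N, by push_cast; ring⟩
    have e2 : Complex.exp (2 * Real.pi * Complex.I * N * ((-1 : ℝ) : ℂ)) = 1 := by
      rw [Complex.exp_eq_one_iff]
      exact ⟨-N, by push_cast; ring⟩
    rw [e1, e2, sub_self, zero_div]

lemma integral_cube_ee {m : ℕ} (N : Fin m → ℤ) :
    ∫ β in cube m, ee (∑ j, β j * N j) = if ∀ j, N j = 0 then 2 ^ m else 0 := by
  have hcube : cube m = Set.univ.pi fun _ => Set.Icc (-1 : ℝ) 1 := by
    rw [cube, Set.pi_univ_Icc]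
  rw [hcube, volume_pi, Measure.restrict_pi_pi]
  simp_rw [ee_sum]
  rw [integral_fintype_prod_eq_prod (fun (j : Fin m) (x : ℝ) => ee (x * N j))]
  simp_rw [integral_ee_Icc]
  split_ifs with h
  · simp [h]
  · push Not at h
    obtain ⟨j, hj⟩ := h
    exact Finset.prod_eq_zero (Finset.mem_univ j) (if_neg hj)

open Classical in
lemma vinogradovCount_eq_sum (m k P : ℕ) :
    (vinogradovCount m k P : ℝ) =
      ∑ x ∈ Fintype.piFinset fun _ : Fin k => Finset.Icc (1 : ℤ) P,
      ∑ y ∈ Fintype.piFinset fun _ : Fin k => Finset.Icc (1 : ℤ) P,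
        if ∀ j : Fin m, ∑ i, (x i ^ ((j : ℕ) + 1) - y i ^ ((j : ℕ) + 1)) = 0 then 1 else 0 := by
  set X := Fintype.piFinset fun _ : Fin k => Finset.Icc (1 : ℤ) P with hX
  have hset : {p : (Fin k → ℤ) × (Fin k → ℤ) |
    (∀ i, 1 ≤ p.1 i ∧ p.1 i ≤ P) ∧ (∀ i, 1 ≤ p.2 i ∧ p.2 i ≤ P) ∧
    ∀ j : ℕ, 1 ≤ j → j ≤ m → ∑ i, (p.1 i ^ j - p.2 i ^ j) = 0} =
      ↑((X ×ˢ X).filter fun p => ∀ j : Fin m,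
        ∑ i, (p.1 i ^ ((j : ℕ) + 1) - p.2 i ^ ((j : ℕ) + 1)) = 0) := by
    ext p
    simp only [Set.mem_ofPred_eq, Finset.coe_filter, Finset.mem_product, hX,
      Fintype.mem_piFinset, Finset.mem_Icc, and_assoc]
    refine and_congr_right fun _ => and_congr_right fun _ => ⟨fun h j => ?_, fun h j h1 h2 => ?_⟩
    · exact h _ (by omega) (by omega)
    · have := h ⟨j - 1, by omega⟩
      simpa only [Nat.sub_add_cancel h1] using this
  rw [vinogradovCount, hset, Set.ncard_coe_finset, Finset.card_filter, Nat.cast_sum,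
    Finset.sum_product]
  push_cast
  rfl

/-- The mean value of an exponential sum over integers counts solutions of the Vinogradov system. -/
lemma curveMean_eq_vinogradovCount {m k P : ℕ} (hP : 1 ≤ P) {w : ℝ} (hw : 0 ≤ w)
    (ν : Measure ℝ) [IsFiniteMeasure ν]
    (hν : ∀ᵐ x ∂ν, x ∈ (Finset.Icc (1 : ℤ) P).image (fun n : ℤ => (n : ℝ)))
    (hνw : ∀ n ∈ Finset.Icc (1 : ℤ) P, ν.real {(n : ℝ)} = w) :
    curveMean m k P 0 ν = 2 ^ m * w ^ (2 * k) * vinogradovCount m k P := by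
  classical
  set s := Finset.Icc (1 : ℤ) P with hs
  set X := Fintype.piFinset fun _ : Fin k => s with hX
  set φ : (Fin m → ℝ) → ℤ → ℝ := fun β n => ∑ j, β j * curve m P 0 n j with hφ
  have hcf : ∀ β, cf ν (curve m P 0) β = w * ∑ n ∈ s, ee (φ β n) := by
    intro β
    unfold cf
    have hν' : ∀ᵐ x ∂ν, x ∈ ((s.image (fun n : ℤ => (n : ℝ)) : Finset ℝ) : Set ℝ) := hν
    rw [← Measure.restrict_eq_self_of_ae_mem hν', setIntegral_finset _
      ((integrable_ee_sum ν (continuous_curve m P 0).measurable β).integrableOn),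
      Finset.sum_image (fun a _ b _ h => by exact_mod_cast h), Finset.mul_sum]
    refine Finset.sum_congr rfl fun n hn => ?_
    rw [hνw n hn, Complex.real_smul]
  -- The frequencies are integers, so orthogonality over the cube is exact. The extra factor
  -- P^{m-1-j} is nonzero and does not affect which of them vanish.
  have hN : ∀ (x y : Fin k → ℤ) (β : Fin m → ℝ), ∑ i, φ β (x i) - ∑ i, φ β (y i) =
      ∑ j, β j * (((P : ℤ) ^ (m - 1 - (j : ℕ)) *
        ∑ i, (x i ^ ((j : ℕ) + 1) - y i ^ ((j : ℕ) + 1)) : ℤ) : ℝ) := by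
    intro x y β
    simp only [hφ]
    rw [Finset.sum_comm, Finset.sum_comm (s := Finset.univ (α := Fin k)),
      ← Finset.sum_sub_distrib]
    refine Finset.sum_congr rfl fun j _ => ?_
    rw [← Finset.mul_sum, ← Finset.mul_sum, ← mul_sub]
    simp only [curve, sub_zero]
    rw [← Finset.mul_sum, ← Finset.mul_sum, ← mul_sub, ← Finset.sum_sub_distrib]
    push_cast
    rfl
  have hexp : ∀ β, ((‖cf ν (curve m P 0) β‖ ^ (2 * k) : ℝ) : ℂ) =
      (w : ℂ) ^ (2 * k) * ∑ x ∈ X, ∑ y ∈ X, ee (∑ j, β j *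
        (((P : ℤ) ^ (m - 1 - (j : ℕ)) *
          ∑ i, (x i ^ ((j : ℕ) + 1) - y i ^ ((j : ℕ) + 1)) : ℤ) : ℝ)) := by
    intro β
    have hpow : (∑ n ∈ s, ee (φ β n)) ^ k = ∑ x ∈ X, ee (∑ i, φ β (x i)) := by
      have := Finset.prod_univ_sum (fun _ : Fin k => s) (fun _ n => ee (φ β n))
      rw [Finset.prod_const, Finset.card_univ, Fintype.card_fin] at this
      rw [this]
      exact Finset.sum_congr rfl fun x _ => (ee_sum _ _).symm
    have hpow' : (starRingEnd ℂ) ((∑ n ∈ s, ee (φ β n)) ^ k) =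
        ∑ y ∈ X, ee (-∑ i, φ β (y i)) := by
      rw [hpow, map_sum]
      exact Finset.sum_congr rfl fun x _ => star_ee _
    have hsq : ((‖∑ n ∈ s, ee (φ β n)‖ ^ (2 * k) : ℝ) : ℂ) =
        (∑ n ∈ s, ee (φ β n)) ^ k * (starRingEnd ℂ) ((∑ n ∈ s, ee (φ β n)) ^ k) := by
      rw [Complex.mul_conj, Complex.normSq_eq_norm_sq, norm_pow, ← pow_mul]
      congr 2
      ring
    rw [hcf, norm_mul, mul_pow, Complex.norm_real, Real.norm_of_nonneg hw, Complex.ofReal_mul,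
      hsq, hpow', hpow, Finset.sum_mul_sum]
    push_cast
    congr 1
    refine Finset.sum_congr rfl fun x _ => Finset.sum_congr rfl fun y _ => ?_
    have := hN x y β
    push_cast at this
    rw [← ee_add, ← sub_eq_add_neg, this]
  have hint : ∀ x y : Fin k → ℤ, IntegrableOn (fun β : Fin m → ℝ => ee (∑ j, β j *
        (((P : ℤ) ^ (m - 1 - (j : ℕ)) *
          ∑ i, (x i ^ ((j : ℕ) + 1) - y i ^ ((j : ℕ) + 1)) : ℤ) : ℝ))) (cube m) := by
    intro x y
    refine ContinuousOn.integrableOn_compact isCompact_cube (Continuous.continuousOn ?_)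
    fun_prop
  have hP0 : ∀ j : Fin m, (P : ℤ) ^ (m - 1 - (j : ℕ)) ≠ 0 := fun j => by positivity
  have hC : ((curveMean m k P 0 ν : ℝ) : ℂ) =
      ((2 ^ m * w ^ (2 * k) * vinogradovCount m k P : ℝ) : ℂ) := by
    rw [curveMean, ← integral_complex_ofReal]
    simp_rw [hexp]
    rw [integral_const_mul, integral_finsetSum _ fun x _ => integrable_finsetSum _ fun y _ =>
      hint x y]
    simp_rw [integral_finsetSum _ fun y _ => hint _ y, integral_cube_ee, mul_eq_zero, hP0,
      false_or]
    rw [vinogradovCount_eq_sum]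
    push_cast
    rw [mul_comm ((2 : ℂ) ^ m), mul_assoc]
    congr 1
    rw [Finset.mul_sum]
    refine Finset.sum_congr rfl fun x _ => ?_
    rw [Finset.mul_sum]
    refine Finset.sum_congr rfl fun y _ => ?_
    split_ifs <;> simp
  exact Complex.ofReal_injective hC

lemma mem_Ioc_of_mem_image {P : ℕ} {x : ℝ}
    (hx : x ∈ (Finset.Icc (1 : ℤ) P).image (fun n : ℤ => (n : ℝ))) :
    x ∈ Set.Ioc (-(P : ℝ)) P := by
  rw [Finset.mem_image] at hx
  obtain ⟨n, hn, rfl⟩ := hx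
  rw [Finset.mem_Icc] at hn
  have h1 : (1 : ℝ) ≤ n := by exact_mod_cast hn.1
  have h2 : (n : ℝ) ≤ P := by exact_mod_cast hn.2
  constructor <;> linarith

/-- The P atoms of mass 1/P exhaust the total mass and lie in (-P, P], so truncation changes
nothing; the value of S outside the atoms only matters on a null event. -/
lemma meanValue_uniform {Ω : Type*} [MeasurableSpace Ω] (μ : Measure Ω) [IsProbabilityMeasure μ]
    {S : Ω → ℝ} (hS : Measurable S) (m k : ℕ) {P : ℕ} (hP : 1 ≤ P)
    (hunif : ∀ n : ℕ, 1 ≤ n → n ≤ P → μ.real (S ⁻¹' {(n : ℝ)}) = 1 / (P : ℝ)) :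
    meanValue μ S m k P = 2 ^ m * ((P : ℝ) ^ (2 * k))⁻¹ * (vinogradovCount m k P : ℝ) := by
  have : IsProbabilityMeasure (μ.map S) := Measure.isProbabilityMeasure_map hS.aemeasurable
  have hP0 : (0 : ℝ) < P := by exact_mod_cast hP
  have hw : ∀ n ∈ Finset.Icc (1 : ℤ) P, (μ.map S).real {(n : ℝ)} = 1 / P := by
    intro n hn
    rw [Finset.mem_Icc] at hn
    obtain ⟨N, rfl⟩ := Int.eq_ofNat_of_zero_le (by omega : 0 ≤ n)
    rw [map_measureReal_apply hS (measurableSet_singleton _)]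
    exact hunif N (by omega) (by omega)
  have hae : ∀ᵐ x ∂(μ.map S), x ∈ (Finset.Icc (1 : ℤ) P).image (fun n : ℤ => (n : ℝ)) := by
    have h1 : (μ.map S).real ((Finset.Icc (1 : ℤ) P).image (fun n : ℤ => (n : ℝ)) : Finset ℝ)
        = 1 := by
      rw [← sum_measureReal_singleton, Finset.sum_image (fun a _ b _ h => by exact_mod_cast h),
        Finset.sum_congr rfl hw]
      simp
      field_simp
    have h2 : (μ.map S) ((Finset.Icc (1 : ℤ) P).image (fun n : ℤ => (n : ℝ)) : Finset ℝ) = 1 := by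
      rw [← ofReal_measureReal, h1, ENNReal.ofReal_one]
    exact (prob_compl_eq_zero_iff (Finset.measurableSet _)).mpr h2
  rw [meanValue_eq_curveMean μ hS m k hP0, Measure.restrict_eq_self_of_ae_mem
    (hae.mono fun x hx => mem_Ioc_of_mem_image hx),
    curveMean_eq_vinogradovCount hP (by positivity) _ hae hw, one_div, inv_pow]

/-- Counting measure on {1, …, P} itself has unit masses at most 1, since a half-open unit interval
contains one integer. Its mean value is 2^m times the count, and 2^m ≥ 1 is dropped. -/
lemma MeanBound.vinogradovCount_le {m k : ℕ} {D E : ℝ} (h : MeanBound m k D E) {P : ℕ}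
    (hP : 1 ≤ P) : (vinogradovCount m k P : ℝ) ≤ D * (P : ℝ) ^ E := by
  set s := Finset.Icc (1 : ℤ) P with hs
  set η : Measure ℤ := Measure.count.restrict (s : Set ℤ) with hη
  have hηf : IsFiniteMeasure η :=
    ⟨by rw [hη, Measure.restrict_apply_univ, Measure.count_apply_finset]; simp⟩
  have hcast : Measurable (fun n : ℤ => (n : ℝ)) := measurable_from_top
  set ν : Measure ℝ := η.map (fun n : ℤ => (n : ℝ)) with hν
  have hνf : IsFiniteMeasure ν := by rw [hν]; infer_instance
  have hunit : UnitBounded ν := by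
    intro a
    rw [hν, Measure.map_apply hcast measurableSet_Ioc]
    have : (fun n : ℤ => (n : ℝ)) ⁻¹' Set.Ioc a (a + 1) ⊆ {⌊a⌋ + 1} := by
      intro n hn
      have h1 : ⌊a⌋ < n := Int.floor_lt.mpr hn.1
      have h2 : n ≤ ⌊a + 1⌋ := Int.le_floor.mpr hn.2
      rw [Int.floor_add_one] at h2
      simp only [Set.mem_singleton_iff]
      omega
    calc _ ≤ η {⌊a⌋ + 1} := measure_mono this
      _ ≤ Measure.count {⌊a⌋ + 1} := Measure.restrict_apply_le _ _
      _ = 1 := Measure.count_singleton _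
  have hae : ∀ᵐ x ∂ν, x ∈ s.image (fun n : ℤ => (n : ℝ)) := by
    have hm : MeasurableSet {x : ℝ | x ∈ s.image (fun n : ℤ => (n : ℝ))} :=
      Finset.measurableSet (s.image (fun n : ℤ => (n : ℝ)))
    rw [hν, ae_map_iff hcast.aemeasurable hm]
    filter_upwards [ae_restrict_mem (Finset.measurableSet s)] with n hn
    exact Finset.mem_image_of_mem _ hn
  have hw : ∀ n ∈ s, ν.real {(n : ℝ)} = 1 := by
    intro n hn
    rw [hν, map_measureReal_apply hcast (measurableSet_singleton _)]
    have : (fun n : ℤ => (n : ℝ)) ⁻¹' {(n : ℝ)} = {n} := by ext k; simp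
    rw [this, Measure.real, hη, Measure.restrict_eq_self _ (by simpa using hn)]
    simp
  have h1 := curveMean_eq_vinogradovCount (m := m) (k := k) hP zero_le_one ν hae hw
  have h2 := h P 0 ν (by exact_mod_cast hP) hνf hunit (hae.mono fun x hx => by
    simpa using mem_Ioc_of_mem_image hx)
  rw [h1, one_pow, mul_one] at h2
  refine le_trans (le_mul_of_one_le_left (by positivity) ?_) h2
  exact one_le_pow₀ (by norm_num)

end StochasticVinogradov

end

/-- The stochastic generalization of the Vinogradov mean value theorem. The constant `D` depends
only on `m` and `τ`. The second and third parts are the case of `S` uniform on `{1, …, P}`. -/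
theorem theorem8 (m τ k : ℕ) (hm : 2 < m) (hτ : 1 ≤ τ) (hk : k = m * τ) :
    ∃ D : ℝ, 0 < D ∧
      (∀ (P : ℕ), 1 ≤ P →
        ∀ (Ω : Type*) [MeasurableSpace Ω] (μ : Measure Ω) [IsProbabilityMeasure μ]
          (S : Ω → ℝ), Measurable S →
          StochasticVinogradov.meanValue μ S m k P ≤
            D * (P : ℝ) ^ (2 * (k : ℝ) - StochasticVinogradov.Delta m τ) *
              StochasticVinogradov.concentration μ S ^ (2 * k)) ∧
      (∀ (P : ℕ), 1 ≤ P →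
        ∀ (Ω : Type*) [MeasurableSpace Ω] (μ : Measure Ω) [IsProbabilityMeasure μ]
          (S : Ω → ℝ), Measurable S →
          (∀ n : ℕ, 1 ≤ n → n ≤ P → μ.real (S ⁻¹' {(n : ℝ)}) = 1 / (P : ℝ)) →
          StochasticVinogradov.meanValue μ S m k P =
            2 ^ m * ((P : ℝ) ^ (2 * k))⁻¹ * (StochasticVinogradov.vinogradovCount m k P : ℝ)) ∧
      (∀ (P : ℕ), 1 ≤ P →
        (StochasticVinogradov.vinogradovCount m k P : ℝ) ≤
          D * (P : ℝ) ^ (2 * (k : ℝ) - StochasticVinogradov.Delta m τ)) := by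
  subst hk
  obtain ⟨D, hD, hmean⟩ := StochasticVinogradov.exists_meanBound hm τ
  refine ⟨D, hD, ?_, ?_, ?_⟩
  · intro P hP Ω _ μ _ S hS
    exact hmean.meanValue_le μ hS (by exact_mod_cast hP)
  · intro P hP Ω _ μ _ S hS hunif
    exact StochasticVinogradov.meanValue_uniform μ hS m (m * τ) hP hunif
  · intro P hP
    exact hmean.vinogradovCount_le hP
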